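/- For an integer $n\ge 2$ let $\Lambda_n=\{1,\dots,n-1\}$ and $\Omega_n=\{0,1\}^{\Lambda_n}$. For $\eta\in\Omega_n$ let $\eta^{x,y}$ be $\eta$ with the values at $x$ and $y$ exchanged, and let $\eta^x$ be $\eta$ with the value at $x$ replaced by $1-\eta(x)$. For $\rho\in(0,1)$, the symmetric simple exclusion process with reservoirs of density $\rho$ is the continuous-time Markov chain $(\eta_t)_{t\ge0}$ on $\Omega_n$ with generator $$\mathfrak L_nf(\eta)=n^2\sum_{x=1}^{n-2}\big(f(\eta^{x,x+1})-f(\eta)\big)+n^2\sum_{x\in\{1,n-1\}}\big(\rho(1-\eta(x))+(1-\rho)\eta(x)\big)\big(f(\eta^x)-f(\eta)\big).$$ For $u:\Lambda_n\to[0,1]$ let $\nu^n_{u}$ be the Bernoulli product measure on $\Omega_n$ with density $u$, that is, $\nu^n_u(\eta)=\prod_{x\in\Lambda_n}\{\eta(x)u(x)+(1-\eta(x))(1-u(x))\}$. For $0<\varepsilon_0\le\min\{\rho,1-\rho\}$ and $\kappa\ge0$ let $\mathcal U_{\varepsilon_0,\kappa}$ (which depends also on $\rho$) be the set of differentiable functions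 $u:[0,1]\to[0,1]$ with $\varepsilon_0\le u\le1-\varepsilon_0$, $u(0)=u(1)=\rho$ and $|u'|\le\kappa$ on $[0,1]$. Given $u_0\in\mathcal U_{\varepsilon_0,\kappa}$, start the process from the Bernoulli product measure with density $x\mapsto u_0(x/n)$. Let $\mu^n_t$ be the law of $\eta_t$, let $u^n_t(x)=\mathbb E[\eta_t(x)]$ for $x\in\Lambda_n$ and $u^n_t(0)=u^n_t(n)=\rho$, let $\nu^n_t=\nu^n_{u^n_t}$, and let $H_n(t)=\int f^n_t\log f^n_t\,d\nu^n_t$ with $f^n_t=d\mu^n_t/d\nu^n_t$ be the relative entropy of $\mu^n_t$ with respect to $\nu^n_t$. Theorem. For every $\varepsilon_0>0$ and $\kappa\ge0$ there are constants $C_0=C_0(\varepsilon_0,\kappa)>0$ and $\delta_0=\delta_0(\varepsilon_0,\kappa)>0$ such that, for every $\rho$ with $\varepsilon_0\le\min\{\rho,1-\rho\}$, every $u_0\in\mathcal U_{\varepsilon_0,\kappa}$ and every $n\ge2$, $$H_n(t)\le C_0e^{-\delta_0t}\qquad\text{for all }t\ge0 .$$ Moreover, for $n\ge3$ the densities $u^n_t$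 solve the discrete heat equation $\frac{d}{dt}u^n_t(x)=n^2\big(u^n_t(x+1)+u^n_t(x-1)-2u^n_t(x)\big)$ for $x\in\Lambda_n$ and $t\ge0$, with $u^n_t(0)=u^n_t(n)=\rho$ and $u^n_0(x)=u_0(x/n)$ for $x\in\Lambda_n$. -/

import Mathlib

open MeasureTheory ProbabilityTheory Filter Topology Set
open scoped NNReal ENNReal

noncomputable section

namespace SSEP

/-- The bulk `Λ_n = {1, …, n-1}`. -/
abbrev Site (n : ℕ) : Type := {x : ℕ // x ∈ Finset.Ioo 0 n}

/-- Configurations `Ω_n = {0,1}^{Λ_n}`; `true` means "occupied". -/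
abbrev Config (n : ℕ) : Type := Site n → Bool

/-- The occupation number, `0` or `1`, as a real number. -/
def occ (b : Bool) : ℝ := if b then 1 else 0

/-- `η^{x,y}`: the contents of the sites `x` and `y` are exchanged. -/
def exchange {n : ℕ} (x y : Site n) (η : Config n) : Config n :=
  fun z => η (Equiv.swap x y z)

/-- `η^x`: the content of the site `x` is flipped. -/
def flip {n : ℕ} (x : Site n) (η : Config n) : Config n :=
  Function.update η x (!η x)

/-- The generator of the symmetric simple exclusion process on `{1, …, n-1}` with reservoirs of
density `ρ`, in diffusive time scale. The second sum runs over the set `{1, n-1}`. -/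
def generator (n : ℕ) (ρ : ℝ) : (Config n → ℝ) →ₗ[ℝ] (Config n → ℝ) where
  toFun f η :=
    (n : ℝ) ^ 2 * ∑ x : Site n, ∑ y : Site n,
        (if y.1 = x.1 + 1 then f (exchange x y η) - f η else 0)
      + (n : ℝ) ^ 2 * ∑ x : Site n,
        (if x.1 = 1 ∨ x.1 + 1 = n then
          (ρ * (1 - occ (η x)) + (1 - ρ) * occ (η x)) * (f (flip x η) - f η) else 0)
  map_add' f g := by
    funext η
    have h₁ : ∀ x y : Site n,
        (if y.1 = x.1 + 1 then (f + g) (exchange x y η) - (f + g) η else 0)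
          = (if y.1 = x.1 + 1 then f (exchange x y η) - f η else 0)
            + (if y.1 = x.1 + 1 then g (exchange x y η) - g η else 0) := by
      intro x y
      simp only [Pi.add_apply]
      split_ifs <;> ring
    have h₂ : ∀ x : Site n,
        (if x.1 = 1 ∨ x.1 + 1 = n then
          (ρ * (1 - occ (η x)) + (1 - ρ) * occ (η x)) * ((f + g) (flip x η) - (f + g) η) else 0)
          = (if x.1 = 1 ∨ x.1 + 1 = n then
              (ρ * (1 - occ (η x)) + (1 - ρ) * occ (η x)) * (f (flip x η) - f η) else 0)
            + (if x.1 = 1 ∨ x.1 + 1 = n then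
              (ρ * (1 - occ (η x)) + (1 - ρ) * occ (η x)) * (g (flip x η) - g η) else 0) := by
      intro x
      simp only [Pi.add_apply]
      split_ifs <;> ring
    simp only [h₁, h₂, Finset.sum_add_distrib]
    simp only [Pi.add_apply]
    ring
  map_smul' c f := by
    funext η
    simp only [Pi.smul_apply, smul_eq_mul, RingHom.id_apply, Finset.mul_sum, mul_add]
    congr 1
    · refine Finset.sum_congr rfl fun x _ => Finset.sum_congr rfl fun y _ => ?_
      split_ifs <;> ring
    · refine Finset.sum_congr rfl fun x _ => ?_
      split_ifs <;> ring

/-- The Markov semigroup `exp (t L_n)` acting on functions on `Ω_n`. -/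
def semigroup (n : ℕ) (ρ : ℝ) (t : ℝ≥0) : (Config n → ℝ) →L[ℝ] (Config n → ℝ) :=
  NormedSpace.exp ((t : ℝ) • LinearMap.toContinuousLinearMap (generator n ρ))

/-- The Bernoulli product measure on `Ω_n` with density `u`, for `u` with values in `[0,1]`. -/
def bernoulliProduct {n : ℕ} (u : Site n → ℝ) : Measure (Config n) :=
  ∑ η : Config n,
    ENNReal.ofReal (∏ x : Site n, (occ (η x) * u x + (1 - occ (η x)) * (1 - u x))) •
      Measure.dirac η

/-- The class of profiles `U_{ε,κ}` (for the reservoir density `ρ`): differentiable functions on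
`[0,1]` with values in `[ε, 1-ε]`, boundary values `ρ` and derivative bounded by `κ`. -/
structure IsProfile (ρ ε κ : ℝ) (u : ℝ → ℝ) : Prop where
  differentiableOn : DifferentiableOn ℝ u (Icc 0 1)
  mem_Icc : ∀ x ∈ Icc (0 : ℝ) 1, u x ∈ Icc ε (1 - ε)
  left : u 0 = ρ
  right : u 1 = ρ
  abs_deriv_le : ∀ x ∈ Icc (0 : ℝ) 1, |derivWithin u (Icc 0 1) x| ≤ κ

/-- The σ-algebra generated by the process up to time `s`. -/
@[reducible] def past {n : ℕ} {Ω : Type*} (η : ℝ≥0 → Ω → Config n) (s : ℝ≥0) : MeasurableSpace Ω :=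
  ⨆ r ∈ Iic s, MeasurableSpace.comap (η r) inferInstance

/-- Under `P`, `η` is the continuous-time Markov chain on `Ω_n` with càdlàg paths, generated by
`generator n ρ`, and with initial law `ν`. -/
structure IsProcess {n : ℕ} {Ω : Type*} [MeasurableSpace Ω] (ρ : ℝ) (ν : Measure (Config n))
    (P : Measure Ω) (η : ℝ≥0 → Ω → Config n) : Prop where
  measurable : ∀ t, Measurable (η t)
  rightContinuous : ∀ ω t, ContinuousWithinAt (fun s => η s ω) (Ici t) t
  leftLimits : ∀ ω t, ∃ l, Tendsto (fun s => η s ω) (𝓝[<] t) (𝓝 l)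
  initial : P.map (η 0) = ν
  markov : ∀ (s t : ℝ≥0) (f : Config n → ℝ),
    P[fun ω => f (η (s + t) ω) | past η s] =ᵐ[P] fun ω => semigroup n ρ t f (η s ω)

/-- The density `u_t^n(x)`: the expectation of `η_t(x)` for `x` in the bulk, and `ρ` at the
points `0` and `n`. -/
def density {n : ℕ} {Ω : Type*} [MeasurableSpace Ω] (ρ : ℝ) (P : Measure Ω)
    (η : ℝ≥0 → Ω → Config n) (t : ℝ≥0) (x : ℕ) : ℝ :=
  if h : x ∈ Finset.Ioo 0 n then ∫ ω, occ (η t ω ⟨x, h⟩) ∂P else ρ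

/-- The discrete Laplacian, at the points `x = 1, …, n-1`. -/
def discreteLaplacian (n : ℕ) (f : ℕ → ℝ) (x : ℕ) : ℝ :=
  (n : ℝ) ^ 2 * (f (x + 1) + f (x - 1) - 2 * f x)

/-- `u` solves the discrete heat equation on `{0, …, n}` with boundary value `ρ` and initial
value `u₀ (x / n)`. -/
structure IsHeatSolution (n : ℕ) (ρ : ℝ) (u₀ : ℝ → ℝ) (u : ℝ≥0 → ℕ → ℝ) : Prop where
  equation : ∀ (t : ℝ≥0), ∀ x ∈ Finset.Ioo 0 n,
    HasDerivWithinAt (fun s : ℝ => u s.toNNReal x) (discreteLaplacian n (u t) x) (Ici 0) t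
  left : ∀ t, u t 0 = ρ
  right : ∀ t, u t n = ρ
  initial : ∀ x ∈ Finset.Ioo 0 n, u 0 x = u₀ (x / n)

end SSEP

end

/-! The proof is the relative entropy method, with the product measure of the current densities `U`
as reference. The generator acts on occupation numbers as the discrete Laplacian, so `U` solves the
discrete heat equation. When the adjoint generator is applied to the product measure of density `U`,
the part linear in the scores cancels the time derivative of the logarithm of that measure. What is
left is quadratic: `n²` times the sum over bonds of the squared gradient of `U` times a product of
two scores. The expectation of such a product is a normalized two-point correlation, so the error
can be computed and need not be controlled by the entropy.

With `H` the entropy and `D` the Dirichlet form of the square root of the density, this gives `H' ≤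
-D + n² ∑ (∇U)² (-corr) / (χ χ)`, where `χ = U (1 - U)` (`entropy_production_le`,
`sum_score_mul_score`). Three estimates close the argument. Gradients of `U` are `O(e^{-2t} / n)`
(`heat_gradient_le`). Correlations are at least `-O(1/n)` (`neg_corr_le`). A logarithmic Sobolev
inequality `H ≤ C D` holds with `C` independent of `n` (`entropy_le_dirichlet`). The error is then
of order `n² · n · n⁻² e^{-4t} · n⁻¹ = e^{-4t}`, and Grönwall's inequality started from `H(0) = 0`
gives exponential decay.

For `n = 2` there is a single site, every law on it is Bernoulli, and the entropy vanishes. -/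

noncomputable section

namespace SSEP

/-! ### Maximum principle and decay for the reflected heat equation -/

/-- A maximum principle for finite systems of differential inequalities. -/
theorem maximum_principle {ι : Type*} (S : Finset ι) (w w' : ℝ → ι → ℝ)
    (hd : ∀ t, 0 ≤ t → ∀ i ∈ S, HasDerivAt (fun s => w s i) (w' t i) t)
    (h0 : ∀ i ∈ S, w 0 i ≤ 0)
    (hmax : ∀ t, 0 ≤ t → ∀ i ∈ S, 0 < w t i → (∀ j ∈ S, w t j ≤ w t i) → w' t i ≤ 0) :
    ∀ t, 0 ≤ t → ∀ i ∈ S, w t i ≤ 0 := by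
  intro T hT i hi
  -- Subtracting `θ * s` makes the inequality strict: at a positive maximum over all indices and
  -- times the derivative of `w` would be at least `θ > 0`, against `hmax`. Then `θ` tends to `0`.
  suffices h : ∀ θ : ℝ, 0 < θ → w T i ≤ θ * T by
    rcases hT.eq_or_lt with rfl | hT'
    · exact h0 i hi
    · by_contra! hpos
      have h2 := h (w T i / (2 * T)) (by positivity)
      have : w T i / (2 * T) * T = w T i / 2 := by field_simp
      linarith
  intro θ hθ
  have hex : ∀ j ∈ S, ∃ s ∈ Icc (0 : ℝ) T, IsMaxOn (fun s => w s j - θ * s) (Icc 0 T) s := by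
    intro j hj
    refine isCompact_Icc.exists_isMaxOn ⟨0, left_mem_Icc.2 hT⟩ ?_
    intro s hs
    exact ((hd s hs.1 j hj).continuousAt.sub (by fun_prop)).continuousWithinAt
  choose! τ hτ hτmax using hex
  obtain ⟨j, hj, hjmax⟩ := S.exists_max_image (fun j => w (τ j) j - θ * τ j) ⟨i, hi⟩
  have hall : ∀ k ∈ S, ∀ s ∈ Icc (0 : ℝ) T, w s k - θ * s ≤ w (τ j) j - θ * τ j :=
    fun k hk s hs => (hτmax k hk hs).trans (hjmax k hk)
  by_contra! hlt
  have hpos : 0 < w (τ j) j - θ * τ j := by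
    have := hall i hi T (right_mem_Icc.2 hT)
    linarith
  have hτ0 : 0 < τ j := by
    rcases (hτ j hj).1.eq_or_lt with h | h
    · rw [← h] at hpos
      have := h0 j hj
      simp at hpos
      linarith
    · exact h
  have hθτ : 0 < θ * τ j := by positivity
  have hw' := hmax (τ j) hτ0.le j hj (by linarith) fun k hk => by
    have := hall k hk (τ j) (hτ j hj)
    linarith
  have hder : HasDerivAt (fun s => w s j - θ * s) (w' (τ j) j - θ) (τ j) := by
    exact ((hd (τ j) hτ0.le j hj).sub ((hasDerivAt_id (τ j)).const_mul θ)).congr_deriv (by simp)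
  -- Left slopes only, since the maximum may be attained at the final time `T`.
  have hslope := (hasDerivWithinAt_iff_tendsto_slope' (s := Iio (τ j)) (by simp)).1
    hder.hasDerivWithinAt
  have : 0 ≤ w' (τ j) j - θ := by
    refine ge_of_tendsto hslope ?_
    filter_upwards [Ioo_mem_nhdsLT hτ0] with s hs
    rw [slope_def_field]
    refine div_nonneg_of_nonpos ?_ (by linarith [hs.2])
    have := hall j hj s ⟨hs.1.le, hs.2.le.trans (hτ j hj).2⟩
    linarith
  linarith

/-- Oscillation decay for the discrete heat equation on `{0, …, n-1}` with reflecting boundary. -/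
theorem neumann_oscillation_le {n : ℕ} {A : ℝ} (hA : 0 ≤ A) (v : ℝ → ℕ → ℝ)
    (hv : ∀ t, 0 ≤ t → ∀ k, k < n → HasDerivAt (fun s => v s k)
      ((n : ℝ) ^ 2 * ((if k + 1 < n then v t (k + 1) - v t k else 0) +
        (if 0 < k then v t (k - 1) - v t k else 0))) t)
    (h0 : ∀ k, k < n → |v 0 k| ≤ A) :
    ∀ t, 0 ≤ t → ∀ k l, k ≤ l → l < n → v t k - v t l ≤ 4 * A * Real.exp (-2 * t) := by
  rcases Nat.eq_zero_or_pos n with rfl | hn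
  · intro t _ k l _ hl
    omega
  have hn' : (0 : ℝ) < n := by exact_mod_cast hn
  -- A barrier for differences of two values: a concave parabola in `l - k`, increasing up to `l - k
  -- = n`. Its second difference in each variable is `-2 / n²`, so `n²` times its two-dimensional
  -- Laplacian is `-4 ≤ -2 g`, which pays for the factor `e^{-2t}`. The summand `1` makes the
  -- barrier dominate the data at time `0`.
  set g : ℕ × ℕ → ℝ := fun q =>
    1 + ((q.2 : ℝ) - q.1) * (2 * n - ((q.2 : ℝ) - q.1)) / (n : ℝ) ^ 2 with hg
  have hg2 : ∀ q : ℕ × ℕ, g q ≤ 2 := by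
    intro q
    have : ((q.2 : ℝ) - q.1) * (2 * n - ((q.2 : ℝ) - q.1)) / (n : ℝ) ^ 2 ≤ 1 := by
      rw [div_le_one (by positivity)]
      nlinarith [sq_nonneg ((n : ℝ) - ((q.2 : ℝ) - q.1))]
    simp only [hg]
    linarith
  have hg1 : ∀ q : ℕ × ℕ, q.1 ≤ q.2 → q.2 < n → 1 ≤ g q := by
    intro q h1 h2
    have h1' : (q.1 : ℝ) ≤ q.2 := by exact_mod_cast h1
    have h2' : (q.2 : ℝ) < n := by exact_mod_cast h2
    have h3' : (0 : ℝ) ≤ q.1 := by positivity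
    have : 0 ≤ ((q.2 : ℝ) - q.1) * (2 * n - ((q.2 : ℝ) - q.1)) / (n : ℝ) ^ 2 := by
      apply div_nonneg _ (by positivity)
      apply mul_nonneg <;> linarith
    simp only [hg]
    linarith
  set S : Finset (ℕ × ℕ) := (Finset.range n ×ˢ Finset.range n).filter fun q => q.1 ≤ q.2 with hS
  have hmem : ∀ k l, (k, l) ∈ S ↔ k ≤ l ∧ l < n := by
    intro k l
    simp only [hS, Finset.mem_filter, Finset.mem_product, Finset.mem_range]
    omega
  set w : ℝ → ℕ × ℕ → ℝ := fun t q => v t q.1 - v t q.2 - 2 * A * Real.exp (-2 * t) * g q with hw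
  set dv : ℝ → ℕ → ℝ := fun t k => (n : ℝ) ^ 2 * ((if k + 1 < n then v t (k + 1) - v t k else 0) +
        (if 0 < k then v t (k - 1) - v t k else 0)) with hdv
  have key := maximum_principle S w
    (fun t q => dv t q.1 - dv t q.2 + 4 * A * Real.exp (-2 * t) * g q) ?_ ?_ ?_
  · intro t ht k l hkl hl
    have h1 := key t ht (k, l) ((hmem k l).2 ⟨hkl, hl⟩)
    simp only [hw] at h1
    have h2 := hg2 (k, l)
    have h3 : 0 ≤ 2 * A * Real.exp (-2 * t) := by positivity
    nlinarith
  · rintro t ht ⟨k, l⟩ hq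
    obtain ⟨hkl, hl⟩ := (hmem k l).1 hq
    have he : HasDerivAt (fun s : ℝ => Real.exp (-2 * s)) (Real.exp (-2 * t) * -2) t := by
      simpa using ((hasDerivAt_id t).const_mul (-2)).exp
    have := ((hv t ht k (hkl.trans_lt hl)).sub (hv t ht l hl)).sub
      ((he.const_mul (2 * A)).mul_const (g (k, l)))
    refine this.congr_deriv ?_
    simp only [hdv]
    ring
  · rintro ⟨k, l⟩ hq
    obtain ⟨hkl, hl⟩ := (hmem k l).1 hq
    have h1 := abs_le.1 (h0 k (hkl.trans_lt hl))
    have h2 := abs_le.1 (h0 l hl)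
    have h3 := hg1 (k, l) hkl hl
    simp only [hw, mul_zero, Real.exp_zero]
    nlinarith
  · rintro t ht ⟨k, l⟩ hq hpos hmx
    obtain ⟨hkl, hl⟩ := (hmem k l).1 hq
    set B := 2 * A * Real.exp (-2 * t) with hB
    have hB0 : 0 ≤ B := by positivity
    have hkl' : k < l := by
      rcases hkl.eq_or_lt with rfl | h
      · exfalso
        have := hg1 (k, k) le_rfl hl
        simp only [hw, ← hB] at hpos
        nlinarith
      · exact h
    have hkR : (k : ℝ) + 1 ≤ l := by exact_mod_cast hkl'
    have hlR : (l : ℝ) + 1 ≤ n := by exact_mod_cast hl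
    have hk0 : (0 : ℝ) ≤ k := by positivity
    have hstep : ∀ k' l', (k', l') ∈ S →
        (v t k' - v t l') - (v t k - v t l) ≤ B * (g (k', l') - g (k, l)) := by
      intro k' l' h
      have := hmx (k', l') h
      simp only [hw, ← hB] at this
      linarith
    have hn2 : (0 : ℝ) < (n : ℝ) ^ 2 := by positivity
    have hg' : ∀ q : ℕ × ℕ, (n : ℝ) ^ 2 * g q =
        (n : ℝ) ^ 2 + ((q.2 : ℝ) - q.1) * (2 * n - ((q.2 : ℝ) - q.1)) := by
      intro q
      simp only [hg]
      field_simp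
    have hk_part : dv t k ≤ B * -2 := by
      simp only [hdv]
      have e1 := hstep (k + 1) l ((hmem _ _).2 ⟨hkl', hl⟩)
      rw [if_pos (by omega : k + 1 < n)]
      -- At a reflecting end the outward step is missing, but the increment of `g` it would bring is
      -- nonnegative, so the bound persists.
      have e2 : (if 0 < k then v t (k - 1) - v t k else 0)
          ≤ B * ((2 * (n - (l - k)) - 1) / (n : ℝ) ^ 2) := by
        split_ifs with hk
        · have := hstep (k - 1) l ((hmem _ _).2 ⟨by omega, hl⟩)
          have hc : ((k - 1 : ℕ) : ℝ) = k - 1 := by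
            rw [Nat.cast_sub (by omega)]; simp
          have hgg : g (k - 1, l) - g (k, l) = (2 * (n - (l - k)) - 1) / (n : ℝ) ^ 2 := by
            simp only [hg, hc]
            field_simp
            ring
          rw [hgg] at this
          linarith
        · apply mul_nonneg hB0
          apply div_nonneg _ hn2.le
          linarith
      have hgg : g (k + 1, l) - g (k, l) = (- 2 * (n - (l - k)) - 1) / (n : ℝ) ^ 2 := by
        simp only [hg]
        push_cast
        field_simp
        ring
      rw [hgg] at e1
      calc _ ≤ (n : ℝ) ^ 2 * (B * ((- 2 * (n - (l - k)) - 1) / (n : ℝ) ^ 2)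
            + B * ((2 * (n - (l - k)) - 1) / (n : ℝ) ^ 2)) := by
            apply mul_le_mul_of_nonneg_left _ hn2.le
            linarith
        _ = _ := by field_simp; ring
    have hl_part : - dv t l ≤ B * -2 := by
      simp only [hdv]
      have e1 := hstep k (l - 1) ((hmem _ _).2 ⟨by omega, by omega⟩)
      rw [if_pos (by omega : 0 < l)]
      have e2 : - (if l + 1 < n then v t (l + 1) - v t l else 0)
          ≤ B * ((2 * (n - (l - k)) - 1) / (n : ℝ) ^ 2) := by
        split_ifs with hk
        · have := hstep k (l + 1) ((hmem _ _).2 ⟨by omega, hk⟩)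
          have hgg : g (k, l + 1) - g (k, l) = (2 * (n - (l - k)) - 1) / (n : ℝ) ^ 2 := by
            simp only [hg]
            push_cast
            field_simp
            ring
          rw [hgg] at this
          linarith
        · rw [neg_zero]
          apply mul_nonneg hB0
          apply div_nonneg _ hn2.le
          linarith
      have hc : ((l - 1 : ℕ) : ℝ) = l - 1 := by
        rw [Nat.cast_sub (by omega)]; simp
      have hgg : g (k, l - 1) - g (k, l) = (- 2 * (n - (l - k)) - 1) / (n : ℝ) ^ 2 := by
        simp only [hg, hc]
        field_simp
        ring
      rw [hgg] at e1
      calc _ = (n : ℝ) ^ 2 * (- (v t (l - 1) - v t l)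
            + - (if l + 1 < n then v t (l + 1) - v t l else 0)) := by ring
        _ ≤ (n : ℝ) ^ 2 * (B * ((- 2 * (n - (l - k)) - 1) / (n : ℝ) ^ 2)
            + B * ((2 * (n - (l - k)) - 1) / (n : ℝ) ^ 2)) := by
            apply mul_le_mul_of_nonneg_left _ hn2.le
            linarith
        _ = _ := by field_simp; ring
    have h2 := hg2 (k, l)
    have h3 : 4 * A * Real.exp (-2 * t) * g (k, l) = 2 * (B * g (k, l)) := by
      rw [hB]; ring
    have h4 : B * g (k, l) ≤ B * 2 := mul_le_mul_of_nonneg_left h2 hB0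
    simp only
    linarith

/-- Gradient decay for a mean-zero solution of the reflected discrete heat equation. -/
theorem neumann_abs_le {n : ℕ} {A : ℝ} (hA : 0 ≤ A) (v : ℝ → ℕ → ℝ)
    (hv : ∀ t, 0 ≤ t → ∀ k, k < n → HasDerivAt (fun s => v s k)
      ((n : ℝ) ^ 2 * ((if k + 1 < n then v t (k + 1) - v t k else 0) +
        (if 0 < k then v t (k - 1) - v t k else 0))) t)
    (h0 : ∀ k, k < n → |v 0 k| ≤ A) (hsum : ∀ t, 0 ≤ t → ∑ k ∈ Finset.range n, v t k = 0) :
    ∀ t, 0 ≤ t → ∀ k, k < n → |v t k| ≤ 4 * A * Real.exp (-2 * t) := by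
  intro t ht k hk
  have hup := neumann_oscillation_le hA v hv h0 t ht
  have hlo := neumann_oscillation_le hA (fun t k => - v t k) (fun t ht k hk => by
    refine (hv t ht k hk).neg.congr_deriv ?_
    split_ifs <;> ring) (fun k hk => by simpa using h0 k hk) t ht
  have hosc : ∀ l ∈ Finset.range n, |v t k - v t l| ≤ 4 * A * Real.exp (-2 * t) := by
    intro l hl
    rw [Finset.mem_range] at hl
    rw [abs_le]
    rcases le_total k l with h | h
    · have h1 := hup k l h hl
      have h2 := hlo k l h hl
      constructor <;> linarith
    · have h1 := hup l k h hk
      have h2 := hlo l k h hk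
      constructor <;> linarith
  have hn' : (0 : ℝ) < n := by exact_mod_cast (by omega : 0 < n)
  -- For a mean-zero solution each value is the average of its differences from all values, so the
  -- oscillation bounds the values.
  have hs : ∑ l ∈ Finset.range n, (v t k - v t l) = n * v t k := by
    rw [Finset.sum_sub_distrib, hsum t ht]
    simp
  have h1 : |(n : ℝ) * v t k| ≤ n * (4 * A * Real.exp (-2 * t)) := by
    rw [← hs]
    refine (Finset.abs_sum_le_sum_abs _ _).trans ((Finset.sum_le_sum hosc).trans_eq ?_)
    simp
  rw [abs_mul, abs_of_pos hn'] at h1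
  exact le_of_mul_le_mul_left h1 hn'

/-! ### The generator on one- and two-point functions -/

theorem exchange_exchange {n : ℕ} (x y : Site n) (η : Config n) :
    exchange x y (exchange x y η) = η := by
  funext z
  simp [exchange]

theorem flip_flip {n : ℕ} (x : Site n) (η : Config n) : flip x (flip x η) = η := by
  simp [flip]

theorem sum_comp_exchange {n : ℕ} (x y : Site n) (F : Config n → ℝ) :
    ∑ η, F (exchange x y η) = ∑ η, F η :=
  Equiv.sum_comp (Function.Involutive.toPerm _ (exchange_exchange x y)) F

theorem sum_comp_flip {n : ℕ} (x : Site n) (F : Config n → ℝ) :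
    ∑ η, F (flip x η) = ∑ η, F η :=
  Equiv.sum_comp (Function.Involutive.toPerm _ (flip_flip x)) F

theorem occ_not (b : Bool) : occ (!b) = 1 - occ b := by
  cases b <;> simp [occ]

theorem occ_mul_self (b : Bool) : occ b * occ b = occ b := by
  cases b <;> simp [occ]

/-- The rate `ρ (1 - b) + (1 - ρ) b` at which a reservoir flips the content `b`. -/
def rate (ρ : ℝ) (b : Bool) : ℝ := ρ * (1 - occ b) + (1 - ρ) * occ b

theorem generator_apply (n : ℕ) (ρ : ℝ) (f : Config n → ℝ) (η : Config n) :
    generator n ρ f η =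
      (n : ℝ) ^ 2 * ∑ x : Site n, ∑ y : Site n,
        (if y.1 = x.1 + 1 then f (exchange x y η) - f η else 0)
      + (n : ℝ) ^ 2 * ∑ x : Site n,
        (if x.1 = 1 ∨ x.1 + 1 = n then rate ρ (η x) * (f (flip x η) - f η) else 0) := rfl

theorem generator_const (n : ℕ) (ρ c : ℝ) : generator n ρ (fun _ => c) = 0 := by
  funext η
  simp [generator_apply]

/-- The occupation numbers, extended by `ρ` outside the bulk. -/
def extOcc {n : ℕ} (ρ : ℝ) (η : Config n) (k : ℕ) : ℝ :=
  if h : k ∈ Finset.Ioo 0 n then occ (η ⟨k, h⟩) else ρ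

theorem extOcc_site {n : ℕ} (ρ : ℝ) (η : Config n) (z : Site n) :
    extOcc ρ η z.1 = occ (η z) := by
  simp only [extOcc, z.2, dif_pos]

theorem extOcc_of_notMem {n : ℕ} (ρ : ℝ) (η : Config n) {k : ℕ} (h : k ∉ Finset.Ioo 0 n) :
    extOcc ρ η k = ρ := dif_neg h

theorem sum_site_ite {n : ℕ} (k : ℕ) (F : Site n → ℝ) :
    ∑ y : Site n, (if y.1 = k then F y else 0) = if h : k ∈ Finset.Ioo 0 n then F ⟨k, h⟩ else 0 := by
  split_ifs with h
  · rw [Finset.sum_eq_single ⟨k, h⟩]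
    · simp
    · intro y _ hy
      rw [if_neg]
      intro hyk
      exact hy (Subtype.ext hyk)
    · simp
  · refine Finset.sum_eq_zero fun y _ => if_neg ?_
    rintro rfl
    exact h y.2

theorem exchange_left {n : ℕ} (x y : Site n) (η : Config n) : exchange x y η x = η y := by
  simp [exchange]

theorem exchange_right {n : ℕ} (x y : Site n) (η : Config n) : exchange x y η y = η x := by
  simp [exchange]

theorem exchange_of_ne {n : ℕ} {x y z : Site n} (η : Config n) (hx : z ≠ x) (hy : z ≠ y) :
    exchange x y η z = η z := by
  simp [exchange, Equiv.swap_apply_of_ne_of_ne hx hy]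

theorem flip_self {n : ℕ} (x : Site n) (η : Config n) : flip x η x = !η x := by
  simp [flip]

theorem flip_of_ne {n : ℕ} {x z : Site n} (η : Config n) (h : z ≠ x) : flip x η z = η z := by
  simp [flip, h]

/-- The exclusion rule drops out for one-point functions, and a reservoir contributes `ρ - η(z)`,
like a neighbour of density `ρ`. The hypothesis `3 ≤ n` is essential: for `n = 2` the single site
touches one reservoir in the generator but has two boundary neighbours in the Laplacian. -/
theorem generator_occ {n : ℕ} (hn : 3 ≤ n) (ρ : ℝ) (z : Site n) (η : Config n) :
    generator n ρ (fun ξ => occ (ξ z)) η = discreteLaplacian n (extOcc ρ η) z.1 := by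
  have hz := Finset.mem_Ioo.1 z.2
  have h1 : ∀ x y : Site n, (if y.1 = x.1 + 1 then occ (exchange x y η z) - occ (η z) else 0) =
      (if x = z then (if y.1 = z.1 + 1 then occ (η y) - occ (η z) else 0) else 0) +
      (if y = z then (if x.1 = z.1 - 1 then occ (η x) - occ (η z) else 0) else 0) := by
    intro x y
    have hy := Finset.mem_Ioo.1 y.2
    have hx := Finset.mem_Ioo.1 x.2
    by_cases hxz : x = z
    · subst hxz
      by_cases hyx : y = x
      · subst hyx
        have : ¬ (y.1 = y.1 - 1) := by omega
        simp [this]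
      · simp [hyx, exchange_left]
    · by_cases hyz : y = z
      · subst hyz
        have : (y.1 = x.1 + 1) ↔ (x.1 = y.1 - 1) := by omega
        simp [hxz, exchange_right, this]
      · simp [hxz, hyz, exchange_of_ne η (Ne.symm hxz) (Ne.symm hyz)]
  have h2 : ∀ x : Site n, (if x.1 = 1 ∨ x.1 + 1 = n then
      rate ρ (η x) * (occ (flip x η z) - occ (η z)) else 0) =
      if x = z then (if z.1 = 1 ∨ z.1 + 1 = n then ρ - occ (η z) else 0) else 0 := by
    intro x
    by_cases hxz : x = z
    · subst hxz
      simp only [flip_self, occ_not, if_true]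
      split_ifs
      · have := occ_mul_self (η x)
        simp only [rate]
        linear_combination (2 * (2 * ρ - 1)) * this
      · rfl
    · simp [hxz, flip_of_ne η (Ne.symm hxz)]
  rw [generator_apply]
  simp only [h1, h2, Finset.sum_add_distrib]
  rw [Finset.sum_comm (f := fun x y : Site n =>
    if y = z then (if x.1 = z.1 - 1 then occ (η x) - occ (η z) else 0) else 0)]
  have h3 : ∀ (F : Site n → ℝ), (∑ x : Site n, ∑ y : Site n, if x = z then F y else 0) =
      ∑ y, F y := by
    intro F
    rw [Finset.sum_comm]
    simp
  rw [h3, h3, sum_site_ite, sum_site_ite, Finset.sum_ite_eq', if_pos (Finset.mem_univ _)]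
  simp only [discreteLaplacian, extOcc_site]
  simp only [extOcc]
  split_ifs <;> first | ring1 | (exfalso; simp only [Finset.mem_Ioo] at *; omega)

/-- The Leibniz rule fails only for moves changing both sites. The sole such move exchanges `z` and
`w` when they are adjacent, and the correction is the product of the two increments. -/
theorem generator_occ_mul_occ {n : ℕ} (ρ : ℝ) {z w : Site n} (hzw : z.1 < w.1) (η : Config n) :
    generator n ρ (fun ξ => occ (ξ z) * occ (ξ w)) η =
      occ (η z) * generator n ρ (fun ξ => occ (ξ w)) η +
      occ (η w) * generator n ρ (fun ξ => occ (ξ z)) η -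
      (if w.1 = z.1 + 1 then (n : ℝ) ^ 2 * (occ (η z) - occ (η w)) ^ 2 else 0) := by
  have hne : z ≠ w := fun h => by rw [h] at hzw; exact lt_irrefl _ hzw
  have h1 : ∀ x y : Site n, (if y.1 = x.1 + 1 then
        occ (exchange x y η z) * occ (exchange x y η w) - occ (η z) * occ (η w) else 0) =
      occ (η z) * (if y.1 = x.1 + 1 then occ (exchange x y η w) - occ (η w) else 0) +
      occ (η w) * (if y.1 = x.1 + 1 then occ (exchange x y η z) - occ (η z) else 0) -
      (if x = z then (if y = w then
        (if w.1 = z.1 + 1 then (occ (η z) - occ (η w)) ^ 2 else 0) else 0) else 0) := by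
    intro x y
    by_cases hxy : y.1 = x.1 + 1
    · simp only [hxy, if_true]
      have hyx : y ≠ x := fun h => by rw [h] at hxy; omega
      by_cases hxz : x = z
      · subst hxz
        by_cases hyw : y = w
        · subst hyw
          simp only [exchange_left, exchange_right, hxy, if_true]
          ring
        · simp [hyw, exchange_of_ne η hne.symm (Ne.symm hyw)]
          ring
      · rw [if_neg hxz]
        by_cases hyz : y = z
        · subst hyz
          have hxw : w ≠ x := fun h => by rw [h] at hzw; omega
          simp [exchange_of_ne η hxw hne.symm]
          ring
        · simp [exchange_of_ne η (Ne.symm hxz) (Ne.symm hyz)]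
          ring
    · simp only [hxy, if_false, mul_zero, add_zero, zero_sub]
      split_ifs with a b c
      · subst a b; exact absurd c hxy
      all_goals simp
  have h2 : ∀ x : Site n, (if x.1 = 1 ∨ x.1 + 1 = n then
      rate ρ (η x) * (occ (flip x η z) * occ (flip x η w) - occ (η z) * occ (η w)) else 0) =
      occ (η z) * (if x.1 = 1 ∨ x.1 + 1 = n then
        rate ρ (η x) * (occ (flip x η w) - occ (η w)) else 0) +
      occ (η w) * (if x.1 = 1 ∨ x.1 + 1 = n then
        rate ρ (η x) * (occ (flip x η z) - occ (η z)) else 0) := by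
    intro x
    by_cases hxz : x = z
    · subst hxz
      rw [flip_of_ne η hne.symm]
      split_ifs <;> ring
    · rw [flip_of_ne η (Ne.symm hxz)]
      split_ifs <;> ring
  simp only [generator_apply, h1, h2, Finset.sum_add_distrib, Finset.sum_sub_distrib,
    ← Finset.mul_sum]
  have h3 : (∑ x : Site n, ∑ y : Site n, if x = z then (if y = w then
        (if w.1 = z.1 + 1 then (occ (η z) - occ (η w)) ^ 2 else 0) else 0) else 0) =
      (if w.1 = z.1 + 1 then (occ (η z) - occ (η w)) ^ 2 else 0) := by
    rw [Finset.sum_comm]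
    simp
  rw [h3]
  split_ifs <;> ring

/-! ### Weights of Bernoulli product measures -/

/-- The weight of the content `b` of a site of density `a`. -/
def siteWeight (a : ℝ) (b : Bool) : ℝ := occ b * a + (1 - occ b) * (1 - a)

/-- The weight of a configuration under the Bernoulli product measure of density `u`. -/
def weight {n : ℕ} (u : Site n → ℝ) (η : Config n) : ℝ := ∏ x, siteWeight (u x) (η x)

/-- The normalized centred occupation number `(η(x) - u(x)) / (u(x) (1 - u(x)))`, written as
the logarithmic derivative of the site weight. -/
def score (a : ℝ) (b : Bool) : ℝ := (2 * occ b - 1) / siteWeight a b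

theorem siteWeight_mem {ε a : ℝ} (h : a ∈ Icc ε (1 - ε)) (b : Bool) :
    siteWeight a b ∈ Icc ε (1 - ε) := by
  cases b <;> simp only [siteWeight, occ] <;> constructor <;> norm_num <;> linarith [h.1, h.2]

theorem siteWeight_add_not (a : ℝ) (b : Bool) : siteWeight a b + siteWeight a (!b) = 1 := by
  cases b <;> simp [siteWeight, occ]

theorem score_eq {a : ℝ} (h0 : 0 < a) (h1 : a < 1) (b : Bool) :
    score a b = (occ b - a) / (a * (1 - a)) := by
  have : 1 - a ≠ 0 := by linarith
  cases b <;> simp [score, siteWeight, occ] <;> field_simp; norm_num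

theorem weight_pos {n : ℕ} {ε : ℝ} (hε : 0 < ε) {u : Site n → ℝ}
    (hu : ∀ x, u x ∈ Icc ε (1 - ε)) (η : Config n) : 0 < weight u η :=
  Finset.prod_pos fun x _ => hε.trans_le (siteWeight_mem (hu x) _).1

theorem weight_flip {n : ℕ} (u : Site n → ℝ) (x : Site n) (η : Config n) :
    weight u (flip x η) * siteWeight (u x) (η x) = weight u η * siteWeight (u x) (!η x) := by
  simp only [weight]
  rw [Fintype.prod_eq_mul_prod_compl x, Fintype.prod_eq_mul_prod_compl x, flip_self]
  have : ∏ z ∈ {x}ᶜ, siteWeight (u z) (flip x η z) = ∏ z ∈ {x}ᶜ, siteWeight (u z) (η z) := by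
    refine Finset.prod_congr rfl fun z hz => ?_
    rw [flip_of_ne η (by simpa using hz)]
  rw [this]
  ring

theorem weight_exchange {n : ℕ} (u : Site n → ℝ) {x y : Site n} (hxy : x ≠ y) (η : Config n) :
    weight u (exchange x y η) * (siteWeight (u x) (η x) * siteWeight (u y) (η y)) =
      weight u η * (siteWeight (u x) (η y) * siteWeight (u y) (η x)) := by
  simp only [weight]
  have key : ∀ F : Site n → ℝ, ∏ z, F z = F x * F y * ∏ z ∈ {x, y}ᶜ, F z := by
    intro F
    rw [← Finset.prod_mul_prod_compl {x, y}, Finset.prod_pair hxy]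
  rw [key, key (fun z => siteWeight (u z) (η z)), exchange_left, exchange_right]
  have : ∏ z ∈ {x, y}ᶜ, siteWeight (u z) (exchange x y η z) =
      ∏ z ∈ {x, y}ᶜ, siteWeight (u z) (η z) := by
    refine Finset.prod_congr rfl fun z hz => ?_
    simp only [Finset.mem_compl, Finset.mem_insert, Finset.mem_singleton, not_or] at hz
    rw [exchange_of_ne η hz.1 hz.2]
  rw [this]
  ring

/-- Site weights are affine in the density, so the expansion in `u y - u x` stops exactly at second
order. The quadratic term is the source of the error in the entropy estimate. -/
theorem weight_exchange_sub {n : ℕ} {u : Site n → ℝ} {x y : Site n} (hxy : x ≠ y) (η : Config n)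
    (hx : 0 < siteWeight (u x) (η x)) (hy : 0 < siteWeight (u y) (η y)) :
    weight u (exchange x y η) - weight u η = weight u η *
      ((u y - u x) * (score (u x) (η x) - score (u y) (η y)) -
        (u y - u x) ^ 2 * (score (u x) (η x) * score (u y) (η y))) := by
  have h := weight_exchange u hxy η
  have h2 : siteWeight (u x) (η y) * siteWeight (u y) (η x) -
      siteWeight (u x) (η x) * siteWeight (u y) (η y) =
      (u y - u x) * ((2 * occ (η x) - 1) * siteWeight (u y) (η y) -
        siteWeight (u x) (η x) * (2 * occ (η y) - 1)) -
      (u y - u x) ^ 2 * ((2 * occ (η x) - 1) * (2 * occ (η y) - 1)) := by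
    cases η x <;> cases η y <;> simp [siteWeight, occ] <;> ring
  have hne := (mul_pos hx hy).ne'
  apply mul_right_cancel₀ hne
  rw [sub_mul, h, ← mul_sub, h2]
  simp only [score]
  field_simp

/-- The reservoir term is linear in `ρ - u x`: the boundary produces no quadratic error. -/
theorem weight_flip_rate_sub {n : ℕ} {u : Site n → ℝ} (ρ : ℝ) (x : Site n) (η : Config n)
    (hx : 0 < siteWeight (u x) (η x)) :
    weight u (flip x η) * rate ρ (!η x) - weight u η * rate ρ (η x) =
      weight u η * ((ρ - u x) * score (u x) (η x)) := by
  have h := weight_flip u x η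
  apply mul_right_cancel₀ hx.ne'
  have h2 : siteWeight (u x) (!η x) * rate ρ (!η x) - siteWeight (u x) (η x) * rate ρ (η x) =
      (ρ - u x) * (2 * occ (η x) - 1) := by
    cases η x <;> simp [siteWeight, occ, rate] <;> ring
  calc _ = (weight u (flip x η) * siteWeight (u x) (η x)) * rate ρ (!η x) -
        weight u η * (siteWeight (u x) (η x) * rate ρ (η x)) := by ring
    _ = weight u η * ((ρ - u x) * (2 * occ (η x) - 1)) := by rw [h, ← h2]; ring
    _ = _ := by simp only [score]; field_simp

/-! ### A logarithmic Sobolev inequality -/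

theorem sum_weight_eq_one {n : ℕ} (u : Site n → ℝ) : ∑ η, weight u η = 1 := by
  have h : ∏ x : Site n, ∑ b : Bool, siteWeight (u x) b = ∑ η : Config n, weight u η :=
    Fintype.prod_sum _
  rw [← h]
  refine Finset.prod_eq_one fun x _ => ?_
  rw [Fintype.sum_bool]
  exact siteWeight_add_not (u x) true

/-- The average of `h` over the content of the site `x`. -/
def condAvg {n : ℕ} (u : Site n → ℝ) (x : Site n) (h : Config n → ℝ) (η : Config n) : ℝ :=
  siteWeight (u x) true * h (Function.update η x true) +
    siteWeight (u x) false * h (Function.update η x false)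

theorem condAvg_eq {n : ℕ} (u : Site n → ℝ) (x : Site n) (h : Config n → ℝ) (η : Config n) :
    condAvg u x h η = siteWeight (u x) (η x) * h η + siteWeight (u x) (!η x) * h (flip x η) := by
  have hη : Function.update η x (η x) = η := Function.update_eq_self x η
  cases hb : η x
  · rw [hb] at hη
    simp only [condAvg, flip, hη, hb, Bool.not_false]
    ring
  · rw [hb] at hη
    simp only [condAvg, flip, hη, hb, Bool.not_true]

theorem sum_weight_condAvg {n : ℕ} (u : Site n → ℝ) (x : Site n) (h : Config n → ℝ) :
    ∑ η, weight u η * condAvg u x h η = ∑ η, weight u η * h η := by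
  have h1 : ∑ η, weight u η * (siteWeight (u x) (!η x) * h (flip x η)) =
      ∑ η, weight u (flip x η) * (siteWeight (u x) (η x) * h η) := by
    rw [← sum_comp_flip x]
    refine Finset.sum_congr rfl fun η _ => ?_
    rw [flip_flip, flip_self, Bool.not_not]
  simp only [condAvg_eq, mul_add, Finset.sum_add_distrib]
  rw [h1, ← Finset.sum_add_distrib]
  refine Finset.sum_congr rfl fun η _ => ?_
  have h2 := weight_flip u x η
  have h3 := siteWeight_add_not (u x) (η x)
  linear_combination h η * h2 + weight u η * h η * h3

/-- Gibbs' variational inequality on two points. -/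
theorem gibbs_pair {p q a b s r : ℝ} (hp : 0 < p) (hq : 0 < q) (ha : 0 < a)
    (hb : 0 < b) (hs : 0 < s) (hr : 0 < r) :
    p * (a * (Real.log s - Real.log (p * s + q * r))) +
      q * (b * (Real.log r - Real.log (p * s + q * r))) ≤
    p * (a * Real.log a) + q * (b * Real.log b) -
      (p * a + q * b) * Real.log (p * a + q * b) := by
  set m := p * a + q * b with hm
  set σ := p * s + q * r with hσ
  have hm0 : 0 < m := by positivity
  have hσ0 : 0 < σ := by positivity
  -- This is `log x ≤ x - 1` at `x = t m / (σ c)`; the weighted right-hand sides cancel in `k3`.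
  have key : ∀ c t : ℝ, 0 < c → 0 < t →
      c * (Real.log t - Real.log σ) - c * Real.log c + c * Real.log m ≤ t * m / σ - c := by
    intro c t hc ht
    have h1 : Real.log (t * m / (σ * c)) ≤ t * m / (σ * c) - 1 :=
      Real.log_le_sub_one_of_pos (by positivity)
    rw [Real.log_div (by positivity) (by positivity), Real.log_mul ht.ne' hm0.ne',
      Real.log_mul hσ0.ne' hc.ne'] at h1
    have h2 := mul_le_mul_of_nonneg_left h1 hc.le
    have h3 : c * (t * m / (σ * c) - 1) = t * m / σ - c := by field_simp
    rw [h3] at h2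
    linarith
  have k1 := mul_le_mul_of_nonneg_left (key a s ha hs) hp.le
  have k2 := mul_le_mul_of_nonneg_left (key b r hb hr) hq.le
  have k3 : p * (s * m / σ - a) + q * (r * m / σ - b) = 0 := by
    have : p * (s * m / σ - a) + q * (r * m / σ - b) = σ * m / σ - m := by
      rw [hσ, hm]; ring
    rw [this, mul_div_cancel_left₀ _ hσ0.ne', sub_self]
  nlinarith

/-- Subadditivity of the entropy with respect to a product measure. -/
theorem entropy_le_sum_condEntropy {n : ℕ} {ε : ℝ} (hε : 0 < ε) {u : Site n → ℝ}
    (hu : ∀ x, u x ∈ Icc ε (1 - ε)) {f : Config n → ℝ} (hf : ∀ η, 0 < f η)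
    (hf1 : ∑ η, weight u η * f η = 1) :
    ∑ η, weight u η * (f η * Real.log (f η)) ≤
      ∑ x, ∑ η, weight u η * (condAvg u x (fun ξ => f ξ * Real.log (f ξ)) η -
        condAvg u x f η * Real.log (condAvg u x f η)) := by
  have hw : ∀ x b, 0 < siteWeight (u x) b := fun x b => hε.trans_le (siteWeight_mem (hu x) b).1
  -- `S` stands for `f` averaged over the sites of `s`. Averaging over one more site adds a
  -- telescoping term with integrand `f log (S / condAvg S)`, which Gibbs' inequality bounds by the
  -- conditional entropy at that site. With all sites averaged, `S` is the constant `1`.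
  have key : ∀ s : Finset (Site n), ∃ S : Config n → ℝ, (∀ η, 0 < S η) ∧
      (∀ η ξ, (∀ x, x ∉ s → η x = ξ x) → S η = S ξ) ∧ ∑ η, weight u η * S η = 1 ∧
      ∑ η, weight u η * (f η * (Real.log (f η) - Real.log (S η))) ≤
      ∑ x ∈ s, ∑ η, weight u η * (condAvg u x (fun ξ => f ξ * Real.log (f ξ)) η -
        condAvg u x f η * Real.log (condAvg u x f η)) := by
    intro s
    induction s using Finset.induction_on with
    | empty =>
      refine ⟨f, hf, ?_, hf1, by simp⟩
      intro η ξ h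
      rw [show η = ξ from funext fun x => h x (by simp)]
    | insert x s hx ih =>
      obtain ⟨S, hS0, hSind, hS1, hSle⟩ := ih
      refine ⟨condAvg u x S, ?_, ?_, ?_, ?_⟩
      · intro η
        have := hw x true
        have := hw x false
        have := hS0 (Function.update η x true)
        have := hS0 (Function.update η x false)
        simp only [condAvg]
        positivity
      · intro η ξ h
        have hupd : ∀ b, S (Function.update η x b) = S (Function.update ξ x b) := by
          intro b
          refine hSind _ _ fun y hy => ?_
          by_cases hyx : y = x
          · subst hyx; simp
          · simp only [Function.update_of_ne hyx]
            exact h y (by simp [hyx, hy])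
        simp only [condAvg, hupd]
      · rw [sum_weight_condAvg, hS1]
      · rw [Finset.sum_insert hx]
        have hstep : ∑ η, weight u η * (f η * (Real.log (S η) - Real.log (condAvg u x S η))) ≤
            ∑ η, weight u η * (condAvg u x (fun ξ => f ξ * Real.log (f ξ)) η -
              condAvg u x f η * Real.log (condAvg u x f η)) := by
          rw [← sum_weight_condAvg u x]
          refine Finset.sum_le_sum fun η _ => ?_
          refine mul_le_mul_of_nonneg_left ?_ (weight_pos hε hu η).le
          have hidem : ∀ b, condAvg u x S (Function.update η x b) = condAvg u x S η := by
            intro b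
            simp [condAvg]
          rw [condAvg.eq_1 u x (fun η => f η * (Real.log (S η) - Real.log (condAvg u x S η)))]
          rw [hidem, hidem]
          simp only [condAvg]
          exact gibbs_pair (hw x true) (hw x false) (hf _) (hf _) (hS0 _) (hS0 _)
        have hsplit : ∑ η, weight u η * (f η * (Real.log (f η) - Real.log (condAvg u x S η))) =
            ∑ η, weight u η * (f η * (Real.log (S η) - Real.log (condAvg u x S η))) +
            ∑ η, weight u η * (f η * (Real.log (f η) - Real.log (S η))) := by
          rw [← Finset.sum_add_distrib]
          refine Finset.sum_congr rfl fun η _ => ?_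
          ring
        rw [hsplit]
        exact add_le_add hstep hSle
  obtain ⟨S, hS0, hSind, hS1, hSle⟩ := key Finset.univ
  have hone : ∀ η, S η = 1 := by
    intro η
    have : ∀ ξ, S ξ = S η := fun ξ => hSind _ _ fun x hx => absurd (Finset.mem_univ x) hx
    simp only [this, ← Finset.sum_mul, sum_weight_eq_one, one_mul] at hS1
    exact hS1
  simpa [hone] using hSle

/-- By `log x ≤ x - 1` the entropy is at most variance over mean, `p q (a - b)² / m`. Factoring `a -
b` through square roots and using `ε (a + b) ≤ m` removes the denominator. -/
theorem entropy_pair_le {ε p q a b : ℝ} (hε : 0 < ε) (hp : ε ≤ p) (hq : ε ≤ q) (hpq : p + q = 1)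
    (ha : 0 < a) (hb : 0 < b) :
    p * (a * Real.log a) + q * (b * Real.log b) -
      (p * a + q * b) * Real.log (p * a + q * b) ≤ 2 / ε * (√a - √b) ^ 2 := by
  have hp0 := hε.trans_le hp
  have hq0 := hε.trans_le hq
  set m := p * a + q * b with hm
  have hm0 : 0 < m := by positivity
  have key : ∀ c : ℝ, 0 < c → c * Real.log c - c * Real.log m ≤ c * (c / m - 1) := by
    intro c hc
    have h := Real.log_le_sub_one_of_pos (div_pos hc hm0)
    rw [Real.log_div hc.ne' hm0.ne'] at h
    nlinarith
  have k1 := mul_le_mul_of_nonneg_left (key a ha) hp0.le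
  have k2 := mul_le_mul_of_nonneg_left (key b hb) hq0.le
  have h1 : p * (a * (a / m - 1)) + q * (b * (b / m - 1)) = p * q * (a - b) ^ 2 / m := by
    have hq' : q = 1 - p := by linarith
    rw [eq_div_iff hm0.ne']
    have : (p * (a * (a / m - 1)) + q * (b * (b / m - 1))) * m =
        p * (a * (a - m)) + q * (b * (b - m)) := by field_simp
    rw [this, hm, hq']
    ring
  have h2 : p * q * (a - b) ^ 2 / m ≤ 2 / ε * (√a - √b) ^ 2 := by
    rw [div_le_iff₀ hm0]
    have sa := Real.sq_sqrt ha.le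
    have sb := Real.sq_sqrt hb.le
    have h3 : (a - b) ^ 2 = (√a - √b) ^ 2 * (√a + √b) ^ 2 := by
      rw [← mul_pow]
      congr 1
      nlinarith
    have h4 : (√a + √b) ^ 2 ≤ 2 * (a + b) := by nlinarith [sq_nonneg (√a - √b)]
    have h5 : ε * (a + b) ≤ m := by rw [hm]; nlinarith
    have h6 : p * q ≤ 1 := by nlinarith
    have h7 : 2 * (a + b) ≤ 2 / ε * m := by
      rw [div_mul_eq_mul_div, le_div_iff₀ hε]
      linarith
    calc p * q * (a - b) ^ 2 ≤ 1 * (a - b) ^ 2 := mul_le_mul_of_nonneg_right h6 (sq_nonneg _)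
      _ = (√a - √b) ^ 2 * (√a + √b) ^ 2 := by rw [h3, one_mul]
      _ ≤ (√a - √b) ^ 2 * (2 / ε * m) :=
          mul_le_mul_of_nonneg_left (h4.trans h7) (sq_nonneg _)
      _ = _ := by ring
  nlinarith

/-- The logarithmic Sobolev inequality for independent flips. -/
theorem entropy_le_sum_flip {n : ℕ} {ε : ℝ} (hε : 0 < ε) {u : Site n → ℝ}
    (hu : ∀ x, u x ∈ Icc ε (1 - ε)) {f : Config n → ℝ} (hf : ∀ η, 0 < f η)
    (hf1 : ∑ η, weight u η * f η = 1) :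
    ∑ η, weight u η * (f η * Real.log (f η)) ≤
      2 / ε * ∑ x, ∑ η, weight u η * (√(f (flip x η)) - √(f η)) ^ 2 := by
  refine (entropy_le_sum_condEntropy hε hu hf hf1).trans ?_
  rw [Finset.mul_sum]
  refine Finset.sum_le_sum fun x _ => ?_
  rw [Finset.mul_sum]
  refine Finset.sum_le_sum fun η _ => ?_
  rw [mul_left_comm]
  refine mul_le_mul_of_nonneg_left ?_ (weight_pos hε hu η).le
  rw [condAvg_eq, condAvg_eq, ← neg_sub (√(f η)), neg_sq]
  exact entropy_pair_le hε (siteWeight_mem (hu x) _).1 (siteWeight_mem (hu x) _).1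
    (siteWeight_add_not _ _) (hf _) (hf _)

/-! ### Comparison of flips at all sites with the Dirichlet form -/

theorem sqrt_sum_mul_add_sq_le {ι : Type*} [Fintype ι] {w : ι → ℝ} (hw : ∀ i, 0 ≤ w i)
    (f g : ι → ℝ) :
    √(∑ i, w i * (f i + g i) ^ 2) ≤ √(∑ i, w i * f i ^ 2) + √(∑ i, w i * g i ^ 2) := by
  have h : ∀ F : ι → ℝ, √(∑ i, w i * F i ^ 2) =
      ‖(WithLp.toLp 2 fun i => √(w i) * F i : EuclideanSpace ℝ ι)‖ := by
    intro F
    rw [EuclideanSpace.norm_eq]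
    congr 1
    refine Finset.sum_congr rfl fun i _ => ?_
    simp [mul_pow, Real.sq_sqrt (hw i)]
  rw [h, h, h]
  refine (le_of_eq ?_).trans (norm_add_le _ _)
  congr 1
  ext i
  simp [mul_add]

/-- Exchanges almost preserve the measure when the densities are close; with `d = K / n` the factors
collected along `n` bonds stay bounded. -/
theorem weight_exchange_le {n : ℕ} {ε d : ℝ} (hε : 0 < ε) {u : Site n → ℝ}
    (hu : ∀ x, u x ∈ Icc ε (1 - ε)) {x y : Site n} (hxy : x ≠ y) (hd : |u y - u x| ≤ d)
    (η : Config n) : weight u (exchange x y η) ≤ (1 + d / ε ^ 2) * weight u η := by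
  have hx := (siteWeight_mem (hu x) (η x)).1
  have hy := (siteWeight_mem (hu y) (η y)).1
  have hpos : 0 < siteWeight (u x) (η x) * siteWeight (u y) (η y) :=
    mul_pos (hε.trans_le hx) (hε.trans_le hy)
  refine le_of_mul_le_mul_right ?_ hpos
  rw [weight_exchange u hxy, mul_comm (1 + d / ε ^ 2), mul_assoc]
  refine mul_le_mul_of_nonneg_left ?_ (weight_pos hε hu η).le
  have h1 : siteWeight (u x) (η y) * siteWeight (u y) (η x) ≤
      siteWeight (u x) (η x) * siteWeight (u y) (η y) + |u y - u x| := by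
    have a1 := le_abs_self (u y - u x)
    have a2 := neg_abs_le (u y - u x)
    cases η x <;> cases η y <;> simp [siteWeight, occ] <;> nlinarith
  have hd0 : 0 ≤ d := (abs_nonneg _).trans hd
  have h2 : ε ^ 2 ≤ siteWeight (u x) (η x) * siteWeight (u y) (η y) := by
    rw [sq]
    exact mul_le_mul hx hy hε.le (hε.trans_le hx).le
  have h3 : d ≤ d / ε ^ 2 * (siteWeight (u x) (η x) * siteWeight (u y) (η y)) := by
    rw [div_mul_eq_mul_div, le_div_iff₀ (by positivity)]
    exact mul_le_mul_of_nonneg_left h2 hd0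
  linarith

theorem weight_flip_le {n : ℕ} {ε : ℝ} (hε : 0 < ε) {u : Site n → ℝ}
    (hu : ∀ x, u x ∈ Icc ε (1 - ε)) (x : Site n) (η : Config n) :
    weight u (flip x η) ≤ 1 / ε * weight u η := by
  have hx := siteWeight_mem (hu x) (η x)
  have hx' := siteWeight_mem (hu x) (!η x)
  refine le_of_mul_le_mul_right ?_ (hε.trans_le hx.1)
  rw [weight_flip u x, mul_comm (1 / ε), mul_assoc]
  refine mul_le_mul_of_nonneg_left ?_ (weight_pos hε hu η).le
  rw [div_mul_eq_mul_div, le_div_iff₀ hε, one_mul]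
  have := hx'.2
  nlinarith [hx.1]

/-- The dynamics flips only next to the reservoirs; conjugation by exchanges carries such a flip
into the bulk. -/
theorem flip_eq_conj {n : ℕ} (x y : Site n) (η : Config n) :
    flip y η = exchange x y (flip x (exchange x y η)) := by
  funext z
  by_cases hzy : z = y
  · subst hzy
    rw [flip_self, exchange_right, flip_self, exchange_left]
  · rw [flip_of_ne η hzy]
    by_cases hzx : z = x
    · subst hzx
      rw [exchange_left, flip_of_ne _ (Ne.symm hzy), exchange_right]
    · rw [exchange_of_ne _ hzx hzy, flip_of_ne _ hzx, exchange_of_ne _ hzx hzy]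

/-- The `L²` norm of the increment of `g` along a map of configurations. -/
def incNorm {n : ℕ} (u : Site n → ℝ) (g : Config n → ℝ) (T : Config n → Config n) : ℝ :=
  √(∑ η, weight u η * (g (T η) - g η) ^ 2)

theorem incNorm_sq {n : ℕ} {ε : ℝ} (hε : 0 < ε) {u : Site n → ℝ}
    (hu : ∀ x, u x ∈ Icc ε (1 - ε)) (g : Config n → ℝ) (T : Config n → Config n) :
    incNorm u g T ^ 2 = ∑ η, weight u η * (g (T η) - g η) ^ 2 :=
  Real.sq_sqrt (Finset.sum_nonneg fun η _ => mul_nonneg (weight_pos hε hu η).le (sq_nonneg _))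

theorem sum_weight_comp_exchange_le {n : ℕ} {ε d : ℝ} (hε : 0 < ε) {u : Site n → ℝ}
    (hu : ∀ x, u x ∈ Icc ε (1 - ε)) {x y : Site n} (hxy : x ≠ y) (hd : |u y - u x| ≤ d)
    {h : Config n → ℝ} (hh : ∀ η, 0 ≤ h η) :
    ∑ η, weight u η * h (exchange x y η) ≤ (1 + d / ε ^ 2) * ∑ η, weight u η * h η := by
  rw [← sum_comp_exchange x y, Finset.mul_sum]
  refine Finset.sum_le_sum fun η _ => ?_
  rw [exchange_exchange, ← mul_assoc]
  exact mul_le_mul_of_nonneg_right (weight_exchange_le hε hu hxy hd η) (hh η)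

theorem sum_weight_comp_flip_le {n : ℕ} {ε : ℝ} (hε : 0 < ε) {u : Site n → ℝ}
    (hu : ∀ x, u x ∈ Icc ε (1 - ε)) (x : Site n) {h : Config n → ℝ} (hh : ∀ η, 0 ≤ h η) :
    ∑ η, weight u η * h (flip x η) ≤ 1 / ε * ∑ η, weight u η * h η := by
  rw [← sum_comp_flip x, Finset.mul_sum]
  refine Finset.sum_le_sum fun η _ => ?_
  rw [flip_flip, ← mul_assoc]
  exact mul_le_mul_of_nonneg_right (weight_flip_le hε hu x η) (hh η)

/-- Moving a flip from the site `x` to the site `y` at the price of two exchanges. -/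
theorem incNorm_flip_le {n : ℕ} {ε d : ℝ} (hε : 0 < ε) (hε1 : ε ≤ 1) {u : Site n → ℝ}
    (hu : ∀ x, u x ∈ Icc ε (1 - ε)) {x y : Site n} (hxy : x ≠ y) (hd : |u y - u x| ≤ d)
    (g : Config n → ℝ) :
    incNorm u g (flip y) ≤ (1 + d / ε ^ 2) * incNorm u g (flip x) +
      ((1 + d / ε ^ 2) / ε + 1) * incNorm u g (exchange x y) := by
  have hd0 : 0 ≤ d := (abs_nonneg _).trans hd
  set q := 1 + d / ε ^ 2 with hq
  have hq1 : 1 ≤ q := by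
    have : 0 ≤ d / ε ^ 2 := by positivity
    linarith
  have hw : ∀ η, 0 ≤ weight u η := fun η => (weight_pos hε hu η).le
  have hsqrt : ∀ {r S : ℝ}, 1 ≤ r → √(r * S) ≤ r * √S := by
    intro r S hr
    rw [Real.sqrt_mul (by linarith)]
    refine mul_le_mul_of_nonneg_right ?_ (Real.sqrt_nonneg _)
    rw [Real.sqrt_le_left (by linarith)]
    nlinarith
  have h1 : √(∑ η, weight u η * (g (flip x (exchange x y η)) - g (exchange x y η)) ^ 2) ≤
      q * incNorm u g (flip x) :=
    (Real.sqrt_le_sqrt (sum_weight_comp_exchange_le hε hu hxy hd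
      (h := fun η => (g (flip x η) - g η) ^ 2) fun _ => sq_nonneg _)).trans (hsqrt hq1)
  -- The increment is evaluated at a transformed configuration: undoing the exchange costs `q`,
  -- undoing the flip costs `1 / ε`.
  have h2 : √(∑ η, weight u η * (g (exchange x y (flip x (exchange x y η))) -
      g (flip x (exchange x y η))) ^ 2) ≤ q / ε * incNorm u g (exchange x y) := by
    have e1 := sum_weight_comp_exchange_le hε hu hxy hd
      (h := fun η => (g (exchange x y (flip x η)) - g (flip x η)) ^ 2) fun _ => sq_nonneg _
    have e2 := sum_weight_comp_flip_le hε hu x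
      (h := fun η => (g (exchange x y η) - g η) ^ 2) fun _ => sq_nonneg _
    have e3 := e1.trans (mul_le_mul_of_nonneg_left e2 (by linarith : 0 ≤ q))
    rw [← mul_assoc, mul_one_div] at e3
    refine (Real.sqrt_le_sqrt e3).trans (hsqrt ?_)
    rw [le_div_iff₀ hε]
    linarith
  have h3 : incNorm u g (flip y) = √(∑ η, weight u η *
      (((g (exchange x y (flip x (exchange x y η))) - g (flip x (exchange x y η))) +
        (g (flip x (exchange x y η)) - g (exchange x y η))) +
        (g (exchange x y η) - g η)) ^ 2) := by
    rw [incNorm]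
    congr 1
    refine Finset.sum_congr rfl fun η _ => ?_
    rw [flip_eq_conj x y]
    ring
  rw [h3]
  refine (sqrt_sum_mul_add_sq_le hw _ _).trans ?_
  have h4 := (sqrt_sum_mul_add_sq_le hw
    (fun η => g (exchange x y (flip x (exchange x y η))) - g (flip x (exchange x y η)))
    (fun η => g (flip x (exchange x y η)) - g (exchange x y η))).trans (add_le_add h2 h1)
  have h5 : √(∑ η, weight u η * (g (exchange x y η) - g η) ^ 2) =
    incNorm u g (exchange x y) := rfl
  rw [h5]
  linarith

theorem sum_site {n : ℕ} (F : Site n → ℝ) :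
    ∑ x, F x = ∑ k ∈ Finset.range n, if h : k ∈ Finset.Ioo 0 n then F ⟨k, h⟩ else 0 := by
  rw [← Finset.sum_subset (s₁ := Finset.Ioo 0 n)]
  · rw [← Finset.sum_coe_sort (Finset.Ioo 0 n)]
    refine Finset.sum_congr rfl fun x _ => ?_
    rw [dif_pos x.2]
  · intro k hk
    exact Finset.mem_range.2 (Finset.mem_Ioo.1 hk).2
  · intro k _ hk
    rw [dif_neg hk]

theorem sum_bond {n : ℕ} (G : Site n → Site n → ℝ) :
    (∑ x : Site n, ∑ y : Site n, if y.1 = x.1 + 1 then G x y else 0) =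
      ∑ k ∈ Finset.range n, if h : k ∈ Finset.Ioo 0 n ∧ k + 1 ∈ Finset.Ioo 0 n then
        G ⟨k, h.1⟩ ⟨k + 1, h.2⟩ else 0 := by
  rw [sum_site]
  refine Finset.sum_congr rfl fun k _ => ?_
  by_cases h1 : k ∈ Finset.Ioo 0 n
  · rw [dif_pos h1]
    simp only
    rw [sum_site_ite]
    by_cases h2 : k + 1 ∈ Finset.Ioo 0 n
    · rw [dif_pos h2, dif_pos ⟨h1, h2⟩]
    · rw [dif_neg h2, dif_neg fun h => h2 h.2]
  · rw [dif_neg h1, dif_neg fun h => h1 h.1]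

/-- The Dirichlet form of the generator with respect to the product measure of density `u`. -/
def dirichlet (n : ℕ) (ρ : ℝ) (u : Site n → ℝ) (g : Config n → ℝ) : ℝ :=
  (n : ℝ) ^ 2 * (∑ x : Site n, ∑ y : Site n, if y.1 = x.1 + 1 then
      ∑ η, weight u η * (g (exchange x y η) - g η) ^ 2 else 0) +
    (n : ℝ) ^ 2 * ∑ x : Site n, if x.1 = 1 ∨ x.1 + 1 = n then
      ∑ η, weight u η * (rate ρ (η x) * (g (flip x η) - g η) ^ 2) else 0

theorem rate_mem {ε ρ : ℝ} (h : ρ ∈ Icc ε (1 - ε)) (b : Bool) : rate ρ b ∈ Icc ε (1 - ε) := by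
  cases b <;> simp only [rate, occ] <;> constructor <;> norm_num <;> linarith [h.1, h.2]

/-- The flips at all sites are controlled by the Dirichlet form. -/
theorem sum_flip_le_dirichlet {n : ℕ} (hn : 2 ≤ n) {ε K ρ : ℝ} (hε : 0 < ε) (hK : 0 ≤ K)
    (hρ : ρ ∈ Icc ε (1 - ε)) {u : Site n → ℝ} (hu : ∀ x, u x ∈ Icc ε (1 - ε))
    (hgrad : ∀ x y : Site n, y.1 = x.1 + 1 → |u y - u x| ≤ K / n) (g : Config n → ℝ) :
    ∑ x, ∑ η, weight u η * (g (flip x η) - g η) ^ 2 ≤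
      2 * Real.exp (K / ε ^ 2) ^ 2 * ((1 + K / ε ^ 2) / ε + 1) ^ 2 / ε * dirichlet n ρ u g := by
  have hn0 : (0 : ℝ) < n := by exact_mod_cast (by omega : 0 < n)
  have hn1 : (1 : ℝ) ≤ n := by exact_mod_cast (by omega : 1 ≤ n)
  have hε1 : ε ≤ 1 := by linarith [hρ.1, hρ.2]
  have hw : ∀ η, 0 ≤ weight u η := fun η => (weight_pos hε hu η).le
  set B := (1 + K / ε ^ 2) / ε + 1 with hB
  set Q := Real.exp (K / ε ^ 2) with hQ
  set q := 1 + K / n / ε ^ 2 with hq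
  have hKε : 0 ≤ K / ε ^ 2 := by positivity
  have hq1 : 1 ≤ q := by
    have : 0 ≤ K / n / ε ^ 2 := by positivity
    linarith
  have hqK : q ≤ 1 + K / ε ^ 2 := by
    have : K / n / ε ^ 2 ≤ K / ε ^ 2 :=
      div_le_div_of_nonneg_right (div_le_self hK hn1) (by positivity)
    linarith
  have hB1 : 1 ≤ B := by
    have : 0 ≤ (1 + K / ε ^ 2) / ε := by positivity
    linarith
  have hQ1 : 1 ≤ Q := Real.one_le_exp hKε
  -- Gradients of order `1 / n` are what keeps the product of `n` such factors bounded uniformly in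
  -- `n`.
  have hqQ : ∀ k ≤ n, q ^ k ≤ Q := by
    intro k hk
    refine (pow_le_pow_right₀ hq1 hk).trans ?_
    have h1 : q ≤ Real.exp (K / n / ε ^ 2) := by
      have := Real.add_one_le_exp (K / n / ε ^ 2)
      linarith
    refine (pow_le_pow_left₀ (by linarith) h1 n).trans ?_
    rw [← Real.exp_nat_mul, hQ]
    refine le_of_eq (congrArg _ ?_)
    field_simp
  set a : ℕ → ℝ := fun k => if h : k ∈ Finset.Ioo 0 n then incNorm u g (flip ⟨k, h⟩) else 0 with ha
  set e : ℕ → ℝ := fun k => if h : k ∈ Finset.Ioo 0 n ∧ k + 1 ∈ Finset.Ioo 0 n then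
    incNorm u g (exchange ⟨k, h.1⟩ ⟨k + 1, h.2⟩) else 0 with he
  have ha0 : ∀ k, 0 ≤ a k := by
    intro k
    simp only [ha]
    split_ifs
    · exact Real.sqrt_nonneg _
    · exact le_rfl
  have he0 : ∀ k, 0 ≤ e k := by
    intro k
    simp only [he]
    split_ifs
    · exact Real.sqrt_nonneg _
    · exact le_rfl
  have hstep : ∀ k, 0 < k → k + 1 < n → a (k + 1) ≤ q * a k + B * e k := by
    intro k hk hk1
    have m1 : k ∈ Finset.Ioo 0 n := Finset.mem_Ioo.2 ⟨hk, by omega⟩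
    have m2 : k + 1 ∈ Finset.Ioo 0 n := Finset.mem_Ioo.2 ⟨by omega, hk1⟩
    have hne : (⟨k, m1⟩ : Site n) ≠ ⟨k + 1, m2⟩ := by
      intro h
      have := congrArg Subtype.val h
      simp at this
    have h := incNorm_flip_le hε hε1 hu hne (hgrad _ _ rfl) g
    have hea : a k = incNorm u g (flip ⟨k, m1⟩) := by simp only [ha, m1, dif_pos]
    have hea' : a (k + 1) = incNorm u g (flip ⟨k + 1, m2⟩) := by simp only [ha, m2, dif_pos]
    have hee : e k = incNorm u g (exchange ⟨k, m1⟩ ⟨k + 1, m2⟩) := by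
      simp only [he]
      rw [dif_pos ⟨m1, m2⟩]
    rw [hea, hea', hee]
    refine h.trans (add_le_add le_rfl ?_)
    refine mul_le_mul_of_nonneg_right ?_ (Real.sqrt_nonneg _)
    rw [hB]
    gcongr
  have hind : ∀ k, k + 1 < n → a (k + 1) ≤ q ^ k * (a 1 + B * ∑ j ∈ Finset.range (k + 1), e j) := by
    intro k
    induction k with
    | zero =>
      intro _
      have : 0 ≤ ∑ j ∈ Finset.range (0 + 1), e j := Finset.sum_nonneg fun j _ => he0 j
      have : 0 ≤ B * ∑ j ∈ Finset.range (0 + 1), e j := by positivity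
      simp only [pow_zero, one_mul, zero_add] at *
      linarith
    | succ k ih =>
      intro hk
      have h1 := ih (by omega)
      have h2 := hstep (k + 1) (by omega) hk
      rw [Finset.sum_range_succ _ (k + 1)]
      have hqk : 1 ≤ q ^ (k + 1) := one_le_pow₀ hq1
      have h3 : B * e (k + 1) ≤ q ^ (k + 1) * (B * e (k + 1)) :=
        le_mul_of_one_le_left (mul_nonneg (by linarith) (he0 _)) hqk
      have h4 : q * a (k + 1) ≤
          q * (q ^ k * (a 1 + B * ∑ j ∈ Finset.range (k + 1), e j)) :=
        mul_le_mul_of_nonneg_left h1 (by linarith)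
      calc a (k + 1 + 1) ≤ q * (q ^ k * (a 1 + B * ∑ j ∈ Finset.range (k + 1), e j)) +
            q ^ (k + 1) * (B * e (k + 1)) := by linarith
        _ = _ := by ring
  set E₂ := ∑ j ∈ Finset.range n, e j ^ 2 with hE₂
  -- Cauchy–Schwarz along the path from site `1` costs a factor `n`, and the later sum over `k`
  -- another; together they match the `n²` of the diffusive time scale.
  have hbound : ∀ k ∈ Finset.range n, a k ^ 2 ≤ 2 * Q ^ 2 * B ^ 2 * n * (a 1 ^ 2 + E₂) := by
    intro k hk
    rw [Finset.mem_range] at hk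
    have hE₂0 : 0 ≤ E₂ := Finset.sum_nonneg fun j _ => sq_nonneg _
    rcases Nat.eq_zero_or_pos k with rfl | hk0
    · have : a 0 = 0 := by simp [ha]
      rw [this, zero_pow two_ne_zero]
      positivity
    · obtain ⟨j, rfl⟩ : ∃ j, k = j + 1 := ⟨k - 1, by omega⟩
      set s := ∑ i ∈ Finset.range n, e i with hs
      have hs0 : 0 ≤ s := Finset.sum_nonneg fun j _ => he0 j
      have h1 : a (j + 1) ≤ Q * (a 1 + B * s) := by
        refine (hind j hk).trans ?_
        have hle : ∑ i ∈ Finset.range (j + 1), e i ≤ s :=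
          Finset.sum_le_sum_of_subset_of_nonneg
            (Finset.range_subset_range.2 hk.le) fun i _ _ => he0 i
        have hnn : 0 ≤ ∑ i ∈ Finset.range (j + 1), e i := Finset.sum_nonneg fun j _ => he0 j
        have := ha0 1
        refine mul_le_mul (hqQ j (by omega)) ?_ (by positivity) (by linarith)
        have := mul_le_mul_of_nonneg_left hle (by linarith : 0 ≤ B)
        linarith
      have h2 : s ^ 2 ≤ n * E₂ := by
        have := sq_sum_le_card_mul_sum_sq (s := Finset.range n) (f := e)
        rwa [Finset.card_range] at this
      have h3 : (a 1 + B * s) ^ 2 ≤ 2 * a 1 ^ 2 + 2 * (B ^ 2 * s ^ 2) := by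
        nlinarith [sq_nonneg (a 1 - B * s)]
      have hB2 : 1 ≤ B ^ 2 := one_le_pow₀ hB1
      have h4 : a 1 ^ 2 ≤ B ^ 2 * n * a 1 ^ 2 := by
        refine le_mul_of_one_le_left (sq_nonneg _) ?_
        nlinarith
      have h5 : B ^ 2 * s ^ 2 ≤ B ^ 2 * n * E₂ := by
        have := mul_le_mul_of_nonneg_left h2 (by positivity : 0 ≤ B ^ 2)
        linarith
      calc a (j + 1) ^ 2 ≤ (Q * (a 1 + B * s)) ^ 2 := pow_le_pow_left₀ (ha0 _) h1 2
        _ = Q ^ 2 * (a 1 + B * s) ^ 2 := by ring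
        _ ≤ Q ^ 2 * (2 * (B ^ 2 * n * a 1 ^ 2) + 2 * (B ^ 2 * n * E₂)) := by
            refine mul_le_mul_of_nonneg_left ?_ (sq_nonneg _)
            linarith
        _ = _ := by ring
  have hlhs : ∑ x, ∑ η, weight u η * (g (flip x η) - g η) ^ 2 = ∑ k ∈ Finset.range n, a k ^ 2 := by
    rw [sum_site]
    refine Finset.sum_congr rfl fun k _ => ?_
    simp only [ha]
    split_ifs
    · rw [incNorm_sq hε hu]
    · simp
  -- The reservoir next to site `1` alone suffices; the other one is discarded.
  have hD : (n : ℝ) ^ 2 * (ε * (a 1 ^ 2 + E₂)) ≤ dirichlet n ρ u g := by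
    have h1 : (∑ x : Site n, ∑ y : Site n, if y.1 = x.1 + 1 then
      ∑ η, weight u η * (g (exchange x y η) - g η) ^ 2 else 0) = E₂ := by
      rw [sum_bond, hE₂]
      refine Finset.sum_congr rfl fun k _ => ?_
      simp only [he]
      split_ifs
      · rw [incNorm_sq hε hu]
      · simp
    have m1 : 1 ∈ Finset.Ioo 0 n := Finset.mem_Ioo.2 ⟨by omega, by omega⟩
    have h2 : ε * a 1 ^ 2 ≤ ∑ x : Site n, if x.1 = 1 ∨ x.1 + 1 = n then
      ∑ η, weight u η * (rate ρ (η x) * (g (flip x η) - g η) ^ 2) else 0 := by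
      have h3 : (if ((⟨1, m1⟩ : Site n).1 = 1 ∨ (⟨1, m1⟩ : Site n).1 + 1 = n) then
        ∑ η, weight u η * (rate ρ (η ⟨1, m1⟩) * (g (flip ⟨1, m1⟩ η) - g η) ^ 2) else 0) ≤
          ∑ x : Site n, if x.1 = 1 ∨ x.1 + 1 = n then
      ∑ η, weight u η * (rate ρ (η x) * (g (flip x η) - g η) ^ 2) else 0 := by
        refine Finset.single_le_sum (f := fun x : Site n => if x.1 = 1 ∨ x.1 + 1 = n then
          ∑ η, weight u η * (rate ρ (η x) * (g (flip x η) - g η) ^ 2) else 0)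
          (fun x _ => ?_) (Finset.mem_univ _)
        split_ifs
        · refine Finset.sum_nonneg fun η _ => mul_nonneg (hw η) (mul_nonneg ?_ (sq_nonneg _))
          exact hε.le.trans (rate_mem hρ _).1
        · exact le_rfl
      refine le_trans ?_ h3
      rw [if_pos (Or.inl rfl)]
      simp only [ha, m1, dif_pos]
      rw [incNorm_sq hε hu, Finset.mul_sum]
      refine Finset.sum_le_sum fun η _ => ?_
      rw [mul_left_comm]
      exact mul_le_mul_of_nonneg_left
        (mul_le_mul_of_nonneg_right (rate_mem hρ _).1 (sq_nonneg _)) (hw η)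
    rw [dirichlet, h1]
    have hE₂0 : 0 ≤ E₂ := Finset.sum_nonneg fun j _ => sq_nonneg _
    have h4 : ε * E₂ ≤ E₂ := by nlinarith
    have h5 : (0 : ℝ) ≤ (n : ℝ) ^ 2 := by positivity
    nlinarith [mul_le_mul_of_nonneg_left h2 h5, mul_le_mul_of_nonneg_left h4 h5]
  rw [hlhs]
  calc ∑ k ∈ Finset.range n, a k ^ 2 ≤
        ∑ k ∈ Finset.range n, 2 * Q ^ 2 * B ^ 2 * n * (a 1 ^ 2 + E₂) := Finset.sum_le_sum hbound
    _ = 2 * Q ^ 2 * B ^ 2 / ε * ((n : ℝ) ^ 2 * (ε * (a 1 ^ 2 + E₂))) := by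
        rw [Finset.sum_const, Finset.card_range, nsmul_eq_mul]
        field_simp
    _ ≤ _ := mul_le_mul_of_nonneg_left hD (by positivity)

/-- The inverse of a lower bound for the logarithmic Sobolev constant. -/
def sobolevConst (ε K : ℝ) : ℝ :=
  2 / ε * (2 * Real.exp (K / ε ^ 2) ^ 2 * ((1 + K / ε ^ 2) / ε + 1) ^ 2 / ε)

theorem sobolevConst_pos {ε K : ℝ} (hε : 0 < ε) (hK : 0 ≤ K) : 0 < sobolevConst ε K := by
  unfold sobolevConst
  positivity

/-- The logarithmic Sobolev inequality for the exclusion process with reservoirs, with respect to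
a Bernoulli product measure with a slowly varying density. -/
theorem entropy_le_dirichlet {n : ℕ} (hn : 2 ≤ n) {ε K ρ : ℝ} (hε : 0 < ε) (hK : 0 ≤ K)
    (hρ : ρ ∈ Icc ε (1 - ε)) {u : Site n → ℝ} (hu : ∀ x, u x ∈ Icc ε (1 - ε))
    (hgrad : ∀ x y : Site n, y.1 = x.1 + 1 → |u y - u x| ≤ K / n)
    {f : Config n → ℝ} (hf : ∀ η, 0 < f η) (hf1 : ∑ η, weight u η * f η = 1) :
    ∑ η, weight u η * (f η * Real.log (f η)) ≤
      sobolevConst ε K * dirichlet n ρ u fun η => √(f η) := by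
  have h := sum_flip_le_dirichlet hn hε hK hρ hu hgrad fun η => √(f η)
  refine (entropy_le_sum_flip hε hu hf hf1).trans
    ((mul_le_mul_of_nonneg_left h (by positivity : 0 ≤ 2 / ε)).trans_eq ?_)
  rw [sobolevConst, mul_assoc (2 / ε)]

/-! ### The discrete heat equation -/

theorem heat_le {n : ℕ} {M : ℝ} {U : ℝ → ℕ → ℝ}
    (hU : ∀ t, 0 ≤ t → ∀ k ∈ Finset.Ioo 0 n,
      HasDerivAt (fun s => U s k) (discreteLaplacian n (U t) k) t)
    (hb : ∀ t, 0 ≤ t → ∀ k, k ∉ Finset.Ioo 0 n → U t k ≤ M) (h0 : ∀ k, U 0 k ≤ M) :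
    ∀ t, 0 ≤ t → ∀ k, U t k ≤ M := by
  have key := maximum_principle (Finset.Ioo 0 n) (fun t k => U t k - M)
    (fun t k => discreteLaplacian n (U t) k) (fun t ht k hk => (hU t ht k hk).sub_const M)
    (fun k _ => sub_nonpos.2 (h0 k)) ?_
  · intro t ht k
    by_cases hk : k ∈ Finset.Ioo 0 n
    · exact sub_nonpos.1 (key t ht k hk)
    · exact hb t ht k hk
  · intro t ht k hk hpos hmax
    have hle : ∀ j, U t j ≤ U t k := by
      intro j
      by_cases hj : j ∈ Finset.Ioo 0 n
      · linarith [hmax j hj]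
      · linarith [hb t ht j hj]
    refine mul_nonpos_of_nonneg_of_nonpos (by positivity) ?_
    linarith [hle (k + 1), hle (k - 1)]

/-- With equal constant boundary values, the increments solve the heat equation on the `n` bonds
with reflecting ends, and they telescope to zero. -/
theorem heat_gradient_le {n : ℕ} {A ρ : ℝ} (hA : 0 ≤ A) {U : ℝ → ℕ → ℝ}
    (hU : ∀ t, 0 ≤ t → ∀ k ∈ Finset.Ioo 0 n,
      HasDerivAt (fun s => U s k) (discreteLaplacian n (U t) k) t)
    (hb : ∀ t k, k ∉ Finset.Ioo 0 n → U t k = ρ)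
    (h0 : ∀ k, k < n → |U 0 (k + 1) - U 0 k| ≤ A) :
    ∀ t, 0 ≤ t → ∀ k, k < n → |U t (k + 1) - U t k| ≤ 4 * A * Real.exp (-2 * t) := by
  refine neumann_abs_le hA (fun t k => U t (k + 1) - U t k) ?_ h0 ?_
  · intro t ht k hk
    have hd : ∀ j, HasDerivAt (fun s => U s j)
        (if j ∈ Finset.Ioo 0 n then discreteLaplacian n (U t) j else 0) t := by
      intro j
      split_ifs with hj
      · exact hU t ht j hj
      · have : (fun s => U s j) = fun _ => ρ := funext fun s => hb s j hj
        rw [this]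
        exact hasDerivAt_const t ρ
    refine ((hd (k + 1)).sub (hd k)).congr_deriv ?_
    have hU0 := hb t 0 (by simp)
    have hUn := hb t n (by simp)
    simp only [discreteLaplacian, Finset.mem_Ioo, hk, and_true, Nat.add_sub_cancel,
      Nat.succ_pos, true_and]
    rcases Nat.eq_zero_or_pos k with rfl | hk0
    · simp only [lt_irrefl, if_false]
      split_ifs
      · ring
      · ring
    · have e : k - 1 + 1 = k := by omega
      simp only [hk0, if_true, e]
      split_ifs
      · ring
      · have : k + 1 = n := by omega
        rw [this]
        ring
  · intro t _
    rw [Finset.sum_range_sub, hb t 0 (by simp), hb t n (by simp), sub_self]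

/-! ### Solutions of the forward equation -/

/-- `p` solves the forward equation, and is a probability vector at nonnegative times. -/
structure IsForwardSolution (n : ℕ) (ρ : ℝ) (p : ℝ → Config n → ℝ) : Prop where
  hasDerivAt : ∀ (f : Config n → ℝ) (t : ℝ),
    HasDerivAt (fun s => ∑ η, p s η * f η) (∑ η, p t η * generator n ρ f η) t
  nonneg : ∀ t, 0 ≤ t → ∀ η, 0 ≤ p t η
  sum_eq_one : ∀ t, ∑ η, p t η = 1

/-- The density profile of `p`, extended by `ρ` outside the bulk. -/
def profile {n : ℕ} (ρ : ℝ) (p : ℝ → Config n → ℝ) (t : ℝ) (k : ℕ) : ℝ :=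
  ∑ η, p t η * extOcc ρ η k

/-- The two-point correlation function of `p`. -/
def corr {n : ℕ} (ρ : ℝ) (p : ℝ → Config n → ℝ) (t : ℝ) (q : ℕ × ℕ) : ℝ :=
  ∑ η, p t η * (extOcc ρ η q.1 * extOcc ρ η q.2) - profile ρ p t q.1 * profile ρ p t q.2

namespace IsForwardSolution

variable {n : ℕ} {ρ : ℝ} {p : ℝ → Config n → ℝ}

theorem profile_of_notMem (hp : IsForwardSolution n ρ p) (t : ℝ) {k : ℕ}
    (hk : k ∉ Finset.Ioo 0 n) : profile ρ p t k = ρ := by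
  simp only [profile, extOcc_of_notMem ρ _ hk, ← Finset.sum_mul, hp.sum_eq_one, one_mul]

theorem hasDerivAt_profile (hp : IsForwardSolution n ρ p) (hn : 3 ≤ n) (t : ℝ) {k : ℕ}
    (hk : k ∈ Finset.Ioo 0 n) :
    HasDerivAt (fun s => profile ρ p s k) (discreteLaplacian n (profile ρ p t) k) t := by
  have h := hp.hasDerivAt (fun η => occ (η ⟨k, hk⟩)) t
  have e : ∀ η : Config n, extOcc ρ η k = occ (η ⟨k, hk⟩) := fun η => extOcc_site ρ η ⟨k, hk⟩
  simp only [profile, e]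
  refine h.congr_deriv ?_
  simp only [generator_occ hn, discreteLaplacian, profile]
  rw [Finset.mul_sum (a := (2 : ℝ))]
  rw [← Finset.sum_add_distrib, ← Finset.sum_sub_distrib, Finset.mul_sum]
  refine Finset.sum_congr rfl fun η _ => ?_
  ring

theorem profile_mem (hp : IsForwardSolution n ρ p) (hn : 3 ≤ n) {ε : ℝ}
    (hρ : ρ ∈ Icc ε (1 - ε)) (h0 : ∀ k, profile ρ p 0 k ∈ Icc ε (1 - ε)) {t : ℝ} (ht : 0 ≤ t)
    (k : ℕ) : profile ρ p t k ∈ Icc ε (1 - ε) := by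
  constructor
  · have := heat_le (n := n) (M := -ε) (U := fun t k => - profile ρ p t k) (fun t _ k hk => by
      refine (hp.hasDerivAt_profile hn t hk).neg.congr_deriv ?_
      simp only [discreteLaplacian]
      ring) (fun t _ k hk => by rw [hp.profile_of_notMem t hk]; linarith [hρ.1])
      (fun k => by linarith [(h0 k).1]) t ht k
    linarith
  · exact heat_le (n := n) (fun t _ k hk => hp.hasDerivAt_profile hn t hk)
      (fun t _ k hk => by rw [hp.profile_of_notMem t hk]; linarith [hρ.2])
      (fun k => (h0 k).2) t ht k

theorem profile_gradient_le (hp : IsForwardSolution n ρ p) (hn : 3 ≤ n) {A : ℝ} (hA : 0 ≤ A)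
    (h0 : ∀ k, k < n → |profile ρ p 0 (k + 1) - profile ρ p 0 k| ≤ A) {t : ℝ} (ht : 0 ≤ t)
    {k : ℕ} (hk : k < n) :
    |profile ρ p t (k + 1) - profile ρ p t k| ≤ 4 * A * Real.exp (-2 * t) :=
  heat_gradient_le hA (fun t _ _ hk => hp.hasDerivAt_profile hn t hk)
    (fun t _ hk => hp.profile_of_notMem t hk) h0 t ht k hk

theorem corr_left (hp : IsForwardSolution n ρ p) (t : ℝ) {z : ℕ} (hz : z ∉ Finset.Ioo 0 n)
    (w : ℕ) : corr ρ p t (z, w) = 0 := by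
  simp only [corr, hp.profile_of_notMem t hz, extOcc_of_notMem ρ _ hz]
  simp only [profile, Finset.mul_sum]
  rw [← Finset.sum_sub_distrib]
  exact Finset.sum_eq_zero fun η _ => by ring

theorem corr_right (hp : IsForwardSolution n ρ p) (t : ℝ) {w : ℕ} (hw : w ∉ Finset.Ioo 0 n)
    (z : ℕ) : corr ρ p t (z, w) = 0 := by
  simp only [corr, hp.profile_of_notMem t hw, extOcc_of_notMem ρ _ hw]
  simp only [profile, Finset.sum_mul]
  rw [← Finset.sum_sub_distrib]
  exact Finset.sum_eq_zero fun η _ => by ring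

/-- For adjacent sites, `η(z)² = η(z)` turns the diagonal moments into densities, which combine with
the exchange correction: the diagonal becomes reflecting, with `-(∇U)²` as the only source. -/
theorem hasDerivAt_corr (hp : IsForwardSolution n ρ p) (hn : 3 ≤ n) (t : ℝ) {z w : ℕ}
    (hz : 0 < z) (hzw : z < w) (hw : w < n) :
    HasDerivAt (fun s => corr ρ p s (z, w))
      ((n : ℝ) ^ 2 * (if w = z + 1 then
        corr ρ p t (z - 1, w) + corr ρ p t (z, w + 1) - 2 * corr ρ p t (z, w) -
          (profile ρ p t (z + 1) - profile ρ p t z) ^ 2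
      else corr ρ p t (z - 1, w) + corr ρ p t (z + 1, w) + corr ρ p t (z, w - 1) +
          corr ρ p t (z, w + 1) - 4 * corr ρ p t (z, w))) t := by
  have mz : z ∈ Finset.Ioo 0 n := Finset.mem_Ioo.2 ⟨hz, hzw.trans hw⟩
  have mw : w ∈ Finset.Ioo 0 n := Finset.mem_Ioo.2 ⟨hz.trans hzw, hw⟩
  have hz' : ∀ η : Config n, occ (η ⟨z, mz⟩) = extOcc ρ η z := fun η =>
    (extOcc_site ρ η ⟨z, mz⟩).symm
  have hw' : ∀ η : Config n, occ (η ⟨w, mw⟩) = extOcc ρ η w := fun η =>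
    (extOcc_site ρ η ⟨w, mw⟩).symm
  have h := hp.hasDerivAt (fun η => occ (η ⟨z, mz⟩) * occ (η ⟨w, mw⟩)) t
  have hgen : ∀ η : Config n,
      generator n ρ (fun η => occ (η ⟨z, mz⟩) * occ (η ⟨w, mw⟩)) η =
      extOcc ρ η z * discreteLaplacian n (extOcc ρ η) w +
      extOcc ρ η w * discreteLaplacian n (extOcc ρ η) z -
      (if w = z + 1 then (n : ℝ) ^ 2 * (extOcc ρ η z - extOcc ρ η w) ^ 2 else 0) := by
    intro η
    rw [generator_occ_mul_occ ρ (z := ⟨z, mz⟩) (w := ⟨w, mw⟩) hzw, generator_occ hn,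
      generator_occ hn, hz', hw']
  simp only [hgen] at h
  simp only [hz', hw'] at h
  refine (h.sub ((hp.hasDerivAt_profile hn t mz).mul (hp.hasDerivAt_profile hn t mw))).congr_deriv
    ?_
  have hlap : ∀ a b : ℕ, ∑ η, p t η * (extOcc ρ η a * discreteLaplacian n (extOcc ρ η) b) =
      (n : ℝ) ^ 2 * (∑ η, p t η * (extOcc ρ η a * extOcc ρ η (b + 1)) +
        ∑ η, p t η * (extOcc ρ η a * extOcc ρ η (b - 1)) -
        2 * ∑ η, p t η * (extOcc ρ η a * extOcc ρ η b)) := by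
    intro a b
    rw [Finset.mul_sum, ← Finset.sum_add_distrib, ← Finset.sum_sub_distrib, Finset.mul_sum]
    refine Finset.sum_congr rfl fun η _ => ?_
    simp only [discreteLaplacian]
    ring
  have hsymm : ∀ a b : ℕ, ∑ η, p t η * (extOcc ρ η a * extOcc ρ η b) =
      ∑ η, p t η * (extOcc ρ η b * extOcc ρ η a) := by
    intro a b
    refine Finset.sum_congr rfl fun η _ => ?_
    ring
  have hexp : ∀ a b : ℕ, ∑ η, p t η * (extOcc ρ η a * extOcc ρ η b) =
      corr ρ p t (a, b) + profile ρ p t a * profile ρ p t b := by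
    intro a b
    simp only [corr]
    ring
  simp only [mul_sub, mul_add, Finset.sum_add_distrib, Finset.sum_sub_distrib]
  rw [hlap, hlap, hsymm w, hsymm w, hsymm w]
  by_cases hadj : w = z + 1
  · subst hadj
    simp only [if_true, Nat.add_sub_cancel]
    have hdiag : ∀ a ∈ Finset.Ioo 0 n, ∑ η, p t η * (extOcc ρ η a * extOcc ρ η a) =
        profile ρ p t a := by
      intro a ha
      refine Finset.sum_congr rfl fun η _ => ?_
      have := extOcc_site ρ η ⟨a, ha⟩
      simp only at this
      rw [this, occ_mul_self]
    have hsq : ∑ η, p t η * ((n : ℝ) ^ 2 * (extOcc ρ η z - extOcc ρ η (z + 1)) ^ 2) =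
        (n : ℝ) ^ 2 * (profile ρ p t z + profile ρ p t (z + 1) -
          2 * ∑ η, p t η * (extOcc ρ η z * extOcc ρ η (z + 1))) := by
      rw [← hdiag z mz, ← hdiag (z + 1) mw, ← Finset.sum_add_distrib, Finset.mul_sum,
        ← Finset.sum_sub_distrib, Finset.mul_sum]
      refine Finset.sum_congr rfl fun η _ => ?_
      ring
    rw [hsq, hdiag z mz, hdiag (z + 1) mw]
    simp only [hexp, discreteLaplacian, Nat.add_sub_cancel]
    ring
  · simp only [hadj, if_false, mul_zero, Finset.sum_const_zero, hexp, discreteLaplacian]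
    ring

/-- The two-point correlations are bounded below by a multiple of `-1/n`. -/
theorem neg_corr_le (hp : IsForwardSolution n ρ p) (hn : 3 ≤ n) {K : ℝ}
    (hgrad : ∀ t, 0 ≤ t → ∀ k, k < n → |profile ρ p t (k + 1) - profile ρ p t k| ≤ K / n)
    (h0 : ∀ z w, 0 < z → z < w → w < n → corr ρ p 0 (z, w) = 0) {t : ℝ} (ht : 0 ≤ t) {z w : ℕ}
    (hz : 0 < z) (hzw : z < w) (hw : w < n) :
    - corr ρ p t (z, w) ≤ 2 * K ^ 2 / n := by
  have hn0 : (0 : ℝ) < n := by exact_mod_cast (by omega : 0 < n)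
  -- `z (n - w)` is the barrier: it is discrete harmonic away from the diagonal and vanishes at `z =
  -- 0` and `w = n`, while the reflection on adjacent pairs gives `-(n - 1)`. The prefactor makes
  -- this exceed the source, at most `(K / n)²`.
  set ψ : ℕ × ℕ → ℝ := fun q => 2 * K ^ 2 / (n : ℝ) ^ 3 * (q.1 * (n - q.2)) with hψ
  set S : Finset (ℕ × ℕ) :=
    (Finset.Ioo 0 n ×ˢ Finset.Ioo 0 n).filter fun q => q.1 < q.2 with hS
  have hmem : ∀ k l, (k, l) ∈ S ↔ 0 < k ∧ k < l ∧ l < n := by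
    intro k l
    simp only [hS, Finset.mem_filter, Finset.mem_product, Finset.mem_Ioo]
    omega
  have hψ0 : ∀ k l, l ≤ n → 0 ≤ ψ (k, l) := by
    intro k l hl
    have : (l : ℝ) ≤ n := by exact_mod_cast hl
    have : (0 : ℝ) ≤ n - l := by linarith
    simp only [hψ]
    positivity
  have key := maximum_principle S (fun t q => - corr ρ p t q - ψ q)
    (fun t q => - ((n : ℝ) ^ 2 * (if q.2 = q.1 + 1 then
        corr ρ p t (q.1 - 1, q.2) + corr ρ p t (q.1, q.2 + 1) - 2 * corr ρ p t (q.1, q.2) -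
          (profile ρ p t (q.1 + 1) - profile ρ p t q.1) ^ 2
      else corr ρ p t (q.1 - 1, q.2) + corr ρ p t (q.1 + 1, q.2) + corr ρ p t (q.1, q.2 - 1) +
          corr ρ p t (q.1, q.2 + 1) - 4 * corr ρ p t (q.1, q.2)))) ?_ ?_ ?_ t ht (z, w)
      ((hmem z w).2 ⟨hz, hzw, hw⟩)
  · have h1 : ψ (z, w) ≤ 2 * K ^ 2 / n := by
      have hz1 : (z : ℝ) ≤ n := by exact_mod_cast (hzw.trans hw).le
      have hw1 : (w : ℝ) ≤ n := by exact_mod_cast hw.le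
      have hw0 : (0 : ℝ) ≤ w := by positivity
      have h2 : (z : ℝ) * (n - w) ≤ n * n :=
        mul_le_mul hz1 (by linarith) (by linarith) hn0.le
      calc ψ (z, w) ≤ 2 * K ^ 2 / (n : ℝ) ^ 3 * (n * n) :=
            mul_le_mul_of_nonneg_left h2 (by positivity)
        _ = _ := by field_simp
    linarith
  · rintro s hs ⟨k, l⟩ hq
    obtain ⟨hk, hkl, hl⟩ := (hmem k l).1 hq
    exact (hp.hasDerivAt_corr hn s hk hkl hl).neg.sub_const _
  · rintro ⟨k, l⟩ hq
    obtain ⟨hk, hkl, hl⟩ := (hmem k l).1 hq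
    have := hψ0 k l hl.le
    rw [h0 k l hk hkl hl]
    linarith
  · rintro s hs ⟨k, l⟩ hq hpos hmax
    obtain ⟨hk, hkl, hl⟩ := (hmem k l).1 hq
    -- The comparison extends to boundary pairs, where the correlation is zero, `ψ` is nonnegative
    -- and the maximum is positive.
    have hall : ∀ k' l', k' < l' → l' ≤ n →
        - corr ρ p s (k', l') - ψ (k', l') ≤ - corr ρ p s (k, l) - ψ (k, l) := by
      intro k' l' h1 h2
      by_cases hq' : (k', l') ∈ S
      · exact hmax _ hq'
      · have hc : corr ρ p s (k', l') = 0 := by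
          rw [hmem] at hq'
          rcases Nat.eq_zero_or_pos k' with rfl | hk'
          · exact hp.corr_left s (by simp) _
          · refine hp.corr_right s ?_ _
            rw [Finset.mem_Ioo]
            omega
        have := hψ0 k' l' h2
        rw [hc]
        linarith
    have hc1 : ((k - 1 : ℕ) : ℝ) = k - 1 := by
      rw [Nat.cast_sub (by omega)]; simp
    have hlc : ((l - 1 : ℕ) : ℝ) = l - 1 := by
      rw [Nat.cast_sub (by omega)]; simp
    have a1 := hall (k - 1) l (by omega) hl.le
    have a2 := hall k (l + 1) (by omega) hl
    set m := 2 * K ^ 2 / (n : ℝ) ^ 3 with hm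
    simp only [hψ, hc1, Nat.cast_add, Nat.cast_one] at a1 a2
    rw [← mul_neg]
    simp only
    by_cases hadj : l = k + 1
    · rw [if_pos hadj]
      have hg := hgrad s hs k (by omega)
      have hg2 : (profile ρ p s (k + 1) - profile ρ p s k) ^ 2 ≤ (K / n) ^ 2 := by
        rw [← sq_abs]
        exact pow_le_pow_left₀ (abs_nonneg _) hg 2
      have hlk : (l : ℝ) = k + 1 := by rw [hadj]; simp
      have hm2 : (K / n) ^ 2 ≤ m * (n - 1) := by
        have hn3 : (3 : ℝ) ≤ n := by exact_mod_cast hn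
        rw [hm, div_pow, div_mul_eq_mul_div, div_le_div_iff₀ (by positivity) (by positivity)]
        have : 0 ≤ K ^ 2 * (n : ℝ) ^ 2 := by positivity
        nlinarith
      refine mul_nonpos_of_nonneg_of_nonpos (by positivity) ?_
      rw [hlk] at a1 a2
      have e : m * ((k - 1) * (n - (k + 1))) + m * (k * (n - (k + 1 + 1))) -
          2 * (m * (k * (n - (k + 1)))) = - (m * ((n : ℝ) - 1)) := by ring
      linarith
    · rw [if_neg hadj]
      have a3 := hall (k + 1) l (by omega) hl.le
      have a4 := hall k (l - 1) (by omega) (by omega)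
      simp only [hψ, hlc, Nat.cast_add, Nat.cast_one] at a3 a4
      refine mul_nonpos_of_nonneg_of_nonpos (by positivity) ?_
      linarith

end IsForwardSolution

/-! ### Entropy production -/

/-- This is `log x ≤ x - 1` at `x = √b / √a`. The square it leaves over sums to the Dirichlet form
of the square root. -/
theorem mul_log_sub_log_le {a b : ℝ} (ha : 0 < a) (hb : 0 < b) :
    a * (Real.log b - Real.log a) ≤ (b - a) - (√b - √a) ^ 2 := by
  have sa := Real.sq_sqrt ha.le
  have sb := Real.sq_sqrt hb.le
  have pa := Real.sqrt_pos.2 ha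
  have pb := Real.sqrt_pos.2 hb
  have h1 := Real.log_le_sub_one_of_pos (div_pos pb pa)
  rw [Real.log_div pb.ne' pa.ne', Real.log_sqrt ha.le, Real.log_sqrt hb.le] at h1
  have h2 : a * (√b / √a - 1) = √a * √b - a := by
    rw [mul_sub, mul_one, mul_div_assoc', div_sub' pa.ne', div_eq_iff pa.ne']
    nlinarith
  have h3 := mul_le_mul_of_nonneg_left h1 ha.le
  rw [h2] at h3
  nlinarith

theorem sum_mul_generator_log_le {n : ℕ} {ρ : ℝ} (hρ : ∀ b, 0 ≤ rate ρ b) {u : Site n → ℝ}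
    (hw : ∀ η, 0 ≤ weight u η) {f : Config n → ℝ} (hf : ∀ η, 0 < f η) :
    ∑ η, weight u η * f η * generator n ρ (fun ξ => Real.log (f ξ)) η ≤
      ∑ η, weight u η * generator n ρ f η - dirichlet n ρ u fun η => √(f η) := by
  have hD : (dirichlet n ρ u fun η => √(f η)) = ∑ η, weight u η *
      ((n : ℝ) ^ 2 * (∑ x : Site n, ∑ y : Site n, if y.1 = x.1 + 1 then
        (√(f (exchange x y η)) - √(f η)) ^ 2 else 0) +
      (n : ℝ) ^ 2 * ∑ x : Site n, if x.1 = 1 ∨ x.1 + 1 = n then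
        rate ρ (η x) * (√(f (flip x η)) - √(f η)) ^ 2 else 0) := by
    have hif : ∀ (c : Prop) [Decidable c] (F : Config n → ℝ),
        (if c then ∑ η, weight u η * F η else 0) = ∑ η, weight u η * if c then F η else 0 := by
      intro c _ F
      split_ifs <;> simp
    simp only [mul_add, Finset.sum_add_distrib, dirichlet, hif]
    congr 1
    · rw [Finset.sum_congr rfl fun x _ => Finset.sum_comm, Finset.sum_comm, Finset.mul_sum]
      refine Finset.sum_congr rfl fun η _ => ?_
      simp only [← Finset.mul_sum]
      ring
    · rw [Finset.sum_comm, Finset.mul_sum]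
      refine Finset.sum_congr rfl fun η _ => ?_
      simp only [← Finset.mul_sum]
      ring
  rw [hD, ← Finset.sum_sub_distrib]
  refine Finset.sum_le_sum fun η _ => ?_
  rw [mul_assoc, ← mul_sub]
  refine mul_le_mul_of_nonneg_left ?_ (hw η)
  have hexp : ∀ a b c d m : ℝ, (m * a + m * b) - (m * c + m * d) = m * (a - c) + m * (b - d) := by
    intros; ring
  rw [generator_apply, generator_apply, hexp, mul_add, mul_left_comm, mul_left_comm (f η)]
  simp only [Finset.mul_sum (a := f η), ← Finset.sum_sub_distrib]
  refine add_le_add (mul_le_mul_of_nonneg_left ?_ (by positivity))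
    (mul_le_mul_of_nonneg_left ?_ (by positivity))
  · refine Finset.sum_le_sum fun x _ => Finset.sum_le_sum fun y _ => ?_
    split_ifs
    · exact mul_log_sub_log_le (hf _) (hf _)
    · simp
  · refine Finset.sum_le_sum fun x _ => ?_
    split_ifs
    · rw [mul_left_comm, ← mul_sub]
      exact mul_le_mul_of_nonneg_left (mul_log_sub_log_le (hf _) (hf _)) (hρ _)
    · simp

/-- Summation by parts. -/
theorem sum_discreteLaplacian_mul {n : ℕ} (hn : 3 ≤ n) {ρ : ℝ} {U : ℕ → ℝ} (h0 : U 0 = ρ)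
    (h1 : U n = ρ) (s : Site n → ℝ) :
    ∑ x : Site n, discreteLaplacian n U x.1 * s x =
      (n : ℝ) ^ 2 * (∑ x : Site n, ∑ y : Site n, if y.1 = x.1 + 1 then
        (U y.1 - U x.1) * (s x - s y) else 0) +
      (n : ℝ) ^ 2 * ∑ x : Site n, if x.1 = 1 ∨ x.1 + 1 = n then (ρ - U x.1) * s x else 0 := by
  have e1 : (∑ x : Site n, ∑ y : Site n, if y.1 = x.1 + 1 then
        (U y.1 - U x.1) * (s x - s y) else 0) =
      (∑ x : Site n, ∑ y : Site n, if y.1 = x.1 + 1 then (U y.1 - U x.1) * s x else 0) -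
      ∑ x : Site n, ∑ y : Site n, if y.1 = x.1 - 1 then (U x.1 - U y.1) * s x else 0 := by
    rw [Finset.sum_comm (f := fun x y : Site n =>
      if y.1 = x.1 - 1 then (U x.1 - U y.1) * s x else 0)]
    simp only [← Finset.sum_sub_distrib]
    refine Finset.sum_congr rfl fun x _ => Finset.sum_congr rfl fun y _ => ?_
    have hx := Finset.mem_Ioo.1 x.2
    have hy := Finset.mem_Ioo.1 y.2
    have : x.1 = y.1 - 1 ↔ y.1 = x.1 + 1 := by omega
    simp only [this]
    split_ifs <;> ring
  rw [e1, ← mul_add, ← Finset.sum_sub_distrib, ← Finset.sum_add_distrib, Finset.mul_sum]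
  refine Finset.sum_congr rfl fun x _ => ?_
  rw [sum_site_ite, sum_site_ite]
  obtain ⟨x, hx⟩ := x
  have hx' := Finset.mem_Ioo.1 hx
  simp only [discreteLaplacian, Finset.mem_Ioo]
  by_cases hl : x = 1
  · subst hl
    have : 1 + 1 < n := by omega
    simp [this, h0]
    ring
  · by_cases hr : x + 1 = n
    · have h2 : 0 < x - 1 := by omega
      have h3 : x - 1 < n := by omega
      simp [hr, h1, h2, h3]
      ring
    · have h2 : 0 < x - 1 := by omega
      have h3 : x - 1 < n := by omega
      have h4 : x + 1 < n := by omega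
      simp [hl, hr, h2, h3, h4]
      ring

/-- The adjoint of the generator applied to a product measure. -/
theorem sum_weight_mul_generator {n : ℕ} (hn : 3 ≤ n) {ρ : ℝ} {U : ℕ → ℝ} (h0 : U 0 = ρ)
    (h1 : U n = ρ) (hw : ∀ (x : Site n) b, 0 < siteWeight (U x.1) b) (f : Config n → ℝ) :
    ∑ η, weight (fun x : Site n => U x.1) η * generator n ρ f η =
      ∑ η, weight (fun x : Site n => U x.1) η * f η *
        (∑ x : Site n, discreteLaplacian n U x.1 * score (U x.1) (η x) -
          (n : ℝ) ^ 2 * ∑ x : Site n, ∑ y : Site n, if y.1 = x.1 + 1 then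
            (U y.1 - U x.1) ^ 2 * (score (U x.1) (η x) * score (U y.1) (η y)) else 0) := by
  set ν : Config n → ℝ := weight (fun x : Site n => U x.1) with hν
  -- A change of variables moves the exchange from `f` to the weight, whose increment is known
  -- exactly.
  have hE : ∀ x y : Site n, ∑ η, ν η * (if y.1 = x.1 + 1 then f (exchange x y η) - f η else 0) =
      ∑ η, ν η * f η * (if y.1 = x.1 + 1 then
        (U y.1 - U x.1) * (score (U x.1) (η x) - score (U y.1) (η y)) -
        (U y.1 - U x.1) ^ 2 * (score (U x.1) (η x) * score (U y.1) (η y)) else 0) := by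
    intro x y
    split_ifs with hxy
    · have hne : x ≠ y := fun h => by rw [h] at hxy; omega
      have : ∑ η, ν η * f (exchange x y η) = ∑ η, ν (exchange x y η) * f η := by
        rw [← sum_comp_exchange x y]
        simp only [exchange_exchange]
      simp only [mul_sub (ν _) (f _) (f _), Finset.sum_sub_distrib]
      rw [this, ← Finset.sum_sub_distrib]
      refine Finset.sum_congr rfl fun η _ => ?_
      have h := weight_exchange_sub (u := fun x : Site n => U x.1) hne η (hw x _) (hw y _)
      rw [← hν] at h
      linear_combination f η * h
    · simp
  have hF : ∀ x : Site n, ∑ η, ν η * (if x.1 = 1 ∨ x.1 + 1 = n then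
      rate ρ (η x) * (f (flip x η) - f η) else 0) =
      ∑ η, ν η * f η * (if x.1 = 1 ∨ x.1 + 1 = n then
        (ρ - U x.1) * score (U x.1) (η x) else 0) := by
    intro x
    split_ifs
    · have : ∑ η, ν η * (rate ρ (η x) * f (flip x η)) =
          ∑ η, ν (flip x η) * (rate ρ (!η x) * f η) := by
        rw [← sum_comp_flip x]
        simp only [flip_flip, flip_self]
      simp only [mul_sub, Finset.sum_sub_distrib]
      rw [this, ← Finset.sum_sub_distrib]
      refine Finset.sum_congr rfl fun η _ => ?_
      have h := weight_flip_rate_sub (u := fun x : Site n => U x.1) ρ x η (hw x _)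
      rw [← hν] at h
      linear_combination f η * h
    · simp
  have hlhs : ∑ η, ν η * generator n ρ f η =
      (n : ℝ) ^ 2 * (∑ x : Site n, ∑ y : Site n,
        ∑ η, ν η * (if y.1 = x.1 + 1 then f (exchange x y η) - f η else 0)) +
      (n : ℝ) ^ 2 * ∑ x : Site n, ∑ η, ν η * (if x.1 = 1 ∨ x.1 + 1 = n then
        rate ρ (η x) * (f (flip x η) - f η) else 0) := by
    simp only [generator_apply, mul_add, Finset.sum_add_distrib]
    congr 1
    · rw [Finset.sum_congr rfl fun x _ => Finset.sum_comm, Finset.sum_comm, Finset.mul_sum]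
      refine Finset.sum_congr rfl fun η _ => ?_
      simp only [← Finset.mul_sum]
      ring
    · rw [Finset.sum_comm, Finset.mul_sum]
      refine Finset.sum_congr rfl fun η _ => ?_
      simp only [← Finset.mul_sum]
      ring
  rw [hlhs]
  simp only [hE, hF]
  rw [Finset.sum_congr rfl fun x _ => Finset.sum_comm, Finset.sum_comm, Finset.mul_sum,
    Finset.sum_comm, Finset.mul_sum, ← Finset.sum_add_distrib]
  refine Finset.sum_congr rfl fun η _ => ?_
  simp only [← Finset.mul_sum]
  -- Summation by parts matches the linear terms of bonds and reservoirs with the Laplacian paired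
  -- with the scores.
  rw [sum_discreteLaplacian_mul hn h0 h1]
  have hsplit : (∑ x : Site n, ∑ y : Site n, if y.1 = x.1 + 1 then
        (U y.1 - U x.1) * (score (U x.1) (η x) - score (U y.1) (η y)) -
        (U y.1 - U x.1) ^ 2 * (score (U x.1) (η x) * score (U y.1) (η y)) else 0) =
      (∑ x : Site n, ∑ y : Site n, if y.1 = x.1 + 1 then
        (U y.1 - U x.1) * (score (U x.1) (η x) - score (U y.1) (η y)) else 0) -
      ∑ x : Site n, ∑ y : Site n, if y.1 = x.1 + 1 then
        (U y.1 - U x.1) ^ 2 * (score (U x.1) (η x) * score (U y.1) (η y)) else 0 := by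
    simp only [← Finset.sum_sub_distrib]
    refine Finset.sum_congr rfl fun x _ => Finset.sum_congr rfl fun y _ => ?_
    split_ifs <;> ring
  rw [hsplit]
  ring

/-- Only the loss terms are kept; the constant crudely counts all ordered pairs and all sites at
rate `n²`. -/
theorem neg_mul_le_generator {n : ℕ} {ρ : ℝ} (hρ : ρ ∈ Icc (0 : ℝ) 1) {f : Config n → ℝ}
    (hf : ∀ η, 0 ≤ f η) (η : Config n) :
    -((n : ℝ) ^ 2 * ((Fintype.card (Site n) : ℝ) ^ 2 + Fintype.card (Site n))) * f η ≤
      generator n ρ f η := by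
  have hr : ∀ b, rate ρ b ∈ Icc (0 : ℝ) 1 := by
    simpa using fun b => rate_mem (ε := 0) (ρ := ρ) (by simpa using hρ) b
  rw [generator_apply]
  have h1 : ∑ x : Site n, ∑ y : Site n, (- f η) ≤ ∑ x : Site n, ∑ y : Site n,
        (if y.1 = x.1 + 1 then f (exchange x y η) - f η else 0) := by
    refine Finset.sum_le_sum fun x _ => Finset.sum_le_sum fun y _ => ?_
    split_ifs
    · linarith [hf (exchange x y η)]
    · linarith [hf η]
  have h2 : ∑ x : Site n, (- f η) ≤ ∑ x : Site n,
        (if x.1 = 1 ∨ x.1 + 1 = n then rate ρ (η x) * (f (flip x η) - f η) else 0) := by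
    refine Finset.sum_le_sum fun x _ => ?_
    split_ifs
    · have h := hr (η x)
      nlinarith [hf (flip x η), hf η, mul_nonneg h.1 (hf (flip x η)),
        mul_le_mul_of_nonneg_right h.2 (hf η)]
    · linarith [hf η]
  simp only [Finset.sum_const, nsmul_eq_mul, Finset.card_univ] at h1 h2
  have hn : (0 : ℝ) ≤ (n : ℝ) ^ 2 := by positivity
  nlinarith [mul_le_mul_of_nonneg_left h1 hn, mul_le_mul_of_nonneg_left h2 hn]

namespace IsForwardSolution

variable {n : ℕ} {ρ : ℝ} {p : ℝ → Config n → ℝ}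

theorem hasDerivAt_apply (hp : IsForwardSolution n ρ p) (η : Config n) (t : ℝ) :
    HasDerivAt (fun s => p s η) (∑ ξ, p t ξ * generator n ρ (Pi.single η 1) ξ) t := by
  simpa [Pi.single_apply] using hp.hasDerivAt (Pi.single η 1) t

/-- Mass leaves a configuration at rate at most `c`, so `e^{cs} p` is nondecreasing and positivity
of the initial weights persists. The logarithms below need it. -/
theorem pos (hp : IsForwardSolution n ρ p) (hρ : ρ ∈ Icc (0 : ℝ) 1) (h0 : ∀ η, 0 < p 0 η) {t : ℝ}
    (ht : 0 ≤ t) (η : Config n) : 0 < p t η := by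
  set c : ℝ := (n : ℝ) ^ 2 * ((Fintype.card (Site n) : ℝ) ^ 2 + Fintype.card (Site n)) with hc
  set d : ℝ → ℝ := fun s => ∑ ξ, p s ξ * generator n ρ (Pi.single η 1) ξ with hd
  have hder : ∀ s, HasDerivAt (fun s => Real.exp (c * s) * p s η)
      (Real.exp (c * s) * c * p s η + Real.exp (c * s) * d s) s := by
    intro s
    have he : HasDerivAt (fun s : ℝ => Real.exp (c * s)) (Real.exp (c * s) * c) s := by
      simpa using ((hasDerivAt_id s).const_mul c).exp
    exact he.mul (hp.hasDerivAt_apply η s)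
  have hmono : MonotoneOn (fun s => Real.exp (c * s) * p s η) (Ici 0) := by
    refine monotoneOn_of_deriv_nonneg (convex_Ici 0)
      (fun s _ => (hder s).continuousAt.continuousWithinAt)
      (fun s _ => (hder s).differentiableAt.differentiableWithinAt) fun s hs => ?_
    rw [interior_Ici] at hs
    have hs0 : 0 ≤ s := le_of_lt hs
    rw [(hder s).deriv]
    have h1 : -c * p s η ≤ d s := by
      have h2 : ∑ ξ, p s ξ * (-c * (Pi.single η (1 : ℝ) : Config n → ℝ) ξ) ≤ d s := by
        refine Finset.sum_le_sum fun ξ _ => mul_le_mul_of_nonneg_left ?_ (hp.nonneg s hs0 ξ)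
        refine neg_mul_le_generator hρ (fun ζ => ?_) ξ
        rw [Pi.single_apply]
        split_ifs <;> norm_num
      refine le_trans (le_of_eq ?_) h2
      simp [Pi.single_apply]
      ring
    have := Real.exp_pos (c * s)
    nlinarith
  have := hmono self_mem_Ici ht ht
  simp only [mul_zero, Real.exp_zero, one_mul] at this
  have h1 := (h0 η).trans_le this
  exact pos_of_mul_pos_right h1 (Real.exp_pos _).le

end IsForwardSolution

/-- The relative entropy of `p` with respect to the product measure with the same densities. -/
def entropy {n : ℕ} (ρ : ℝ) (p : ℝ → Config n → ℝ) (t : ℝ) : ℝ :=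
  ∑ η, p t η * (Real.log (p t η) - ∑ x : Site n, Real.log (siteWeight (profile ρ p t x.1) (η x)))

theorem log_weight {n : ℕ} {u : Site n → ℝ} {η : Config n}
    (hw : ∀ x, 0 < siteWeight (u x) (η x)) :
    Real.log (weight u η) = ∑ x, Real.log (siteWeight (u x) (η x)) :=
  Real.log_prod fun x _ => (hw x).ne'

namespace IsForwardSolution

variable {n : ℕ} {ρ : ℝ} {p : ℝ → Config n → ℝ}

/-- The derivative of `log p` contributes only the derivative of the total mass, which is zero; the
derivative of the factor `p` becomes the generator by duality. -/
theorem hasDerivAt_entropy (hp : IsForwardSolution n ρ p) (hn : 3 ≤ n) {t : ℝ}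
    (hpos : ∀ η, 0 < p t η) (hw : ∀ (x : Site n) b, 0 < siteWeight (profile ρ p t x.1) b) :
    HasDerivAt (entropy ρ p)
      (∑ η, p t η * generator n ρ (fun ξ => Real.log (p t ξ) -
          ∑ x : Site n, Real.log (siteWeight (profile ρ p t x.1) (ξ x))) η -
        ∑ η, p t η * ∑ x : Site n, discreteLaplacian n (profile ρ p t) x.1 *
          score (profile ρ p t x.1) (η x)) t := by
  set d : Config n → ℝ := fun η => ∑ ξ, p t ξ * generator n ρ (Pi.single η 1) ξ with hd
  have hdp : ∀ η, HasDerivAt (fun s => p s η) (d η) t := fun η => hp.hasDerivAt_apply η t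
  have hdual : ∀ g : Config n → ℝ, ∑ η, d η * g η = ∑ η, p t η * generator n ρ g η := by
    intro g
    have h1 : HasDerivAt (fun s => ∑ η, p s η * g η) (∑ η, d η * g η) t :=
      HasDerivAt.fun_sum fun η _ => (hdp η).mul_const (g η)
    exact h1.unique (hp.hasDerivAt g t)
  have hd0 : ∑ η, d η = 0 := by
    have := hdual fun _ => 1
    simpa [generator_const] using this
  have hlogw : ∀ (η : Config n) (x : Site n),
      HasDerivAt (fun s => Real.log (siteWeight (profile ρ p s x.1) (η x)))
        (discreteLaplacian n (profile ρ p t) x.1 * score (profile ρ p t x.1) (η x)) t := by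
    intro η x
    have hU := hp.hasDerivAt_profile hn t x.2
    have h1 : HasDerivAt (fun s => siteWeight (profile ρ p s x.1) (η x))
        (occ (η x) * discreteLaplacian n (profile ρ p t) x.1 +
          (1 - occ (η x)) * -discreteLaplacian n (profile ρ p t) x.1) t :=
      (hU.const_mul _).add ((hU.const_sub 1).const_mul _)
    refine (h1.log (hw x _).ne').congr_deriv ?_
    rw [score, mul_div_assoc']
    congr 1
    ring
  have hterm : ∀ η, HasDerivAt (fun s => p s η * (Real.log (p s η) -
      ∑ x : Site n, Real.log (siteWeight (profile ρ p s x.1) (η x))))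
      (d η * (Real.log (p t η) -
        ∑ x : Site n, Real.log (siteWeight (profile ρ p t x.1) (η x))) +
        p t η * (d η / p t η - ∑ x : Site n, discreteLaplacian n (profile ρ p t) x.1 *
          score (profile ρ p t x.1) (η x))) t := fun η =>
    (hdp η).mul (((hdp η).log (hpos η).ne').sub (HasDerivAt.fun_sum fun x _ => hlogw η x))
  have hsum := HasDerivAt.fun_sum fun η (_ : η ∈ Finset.univ) => hterm η
  refine hsum.congr_deriv ?_
  rw [Finset.sum_add_distrib, hdual, sub_eq_add_neg, add_right_inj]
  simp only [mul_sub, Finset.sum_sub_distrib]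
  have : ∑ η, p t η * (d η / p t η) = 0 := by
    rw [← hd0]
    exact Finset.sum_congr rfl fun η _ => mul_div_cancel₀ _ (hpos η).ne'
  rw [this, zero_sub]

/-- The entropy production inequality. -/
theorem entropy_production_le (hp : IsForwardSolution n ρ p) (hn : 3 ≤ n) {t : ℝ}
    (hρ : ∀ b, 0 ≤ rate ρ b)
    (hpos : ∀ η, 0 < p t η) (hw : ∀ (x : Site n) b, 0 < siteWeight (profile ρ p t x.1) b) :
    deriv (entropy ρ p) t ≤
      - dirichlet n ρ (fun x : Site n => profile ρ p t x.1)
        (fun η => √(p t η / weight (fun x : Site n => profile ρ p t x.1) η)) -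
      ∑ η, p t η * ((n : ℝ) ^ 2 * ∑ x : Site n, ∑ y : Site n, if y.1 = x.1 + 1 then
            (profile ρ p t y.1 - profile ρ p t x.1) ^ 2 *
              (score (profile ρ p t x.1) (η x) * score (profile ρ p t y.1) (η y)) else 0) := by
  rw [(hp.hasDerivAt_entropy hn hpos hw).deriv]
  set U := profile ρ p t with hU
  set ν := weight (fun x : Site n => U x.1) with hν
  have hν0 : ∀ η, 0 < ν η := fun η => Finset.prod_pos fun x _ => hw x _
  set f : Config n → ℝ := fun η => p t η / ν η with hf
  have hf0 : ∀ η, 0 < f η := fun η => div_pos (hpos η) (hν0 η)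
  have hνf : ∀ η, ν η * f η = p t η := fun η => mul_div_cancel₀ _ (hν0 η).ne'
  have hlog : (fun ξ => Real.log (p t ξ) -
          ∑ x : Site n, Real.log (siteWeight (U x.1) (ξ x))) = fun ξ => Real.log (f ξ) := by
    funext ξ
    rw [hf, Real.log_div (hpos ξ).ne' (hν0 ξ).ne', hν, log_weight fun x => hw x _]
  have h1 := sum_mul_generator_log_le hρ (u := fun x : Site n => U x.1)
    (fun η => (hν0 η).le) hf0
  have h2 := sum_weight_mul_generator hn (ρ := ρ) (U := U)
    (hp.profile_of_notMem t (by simp)) (hp.profile_of_notMem t (by simp)) hw f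
  rw [← hν] at h1 h2
  rw [h2] at h1
  simp only [hνf] at h1
  rw [hlog]
  simp only [mul_sub, Finset.sum_sub_distrib] at h1
  -- The Laplacian terms cancel here, because the reference measure follows the heat equation.
  linarith

/-- This evaluates the quadratic error exactly, so that a one-sided bound on correlations is all
that remains to be used. -/
theorem sum_score_mul_score (hp : IsForwardSolution n ρ p) {t : ℝ} {x y : Site n}
    (hx : profile ρ p t x.1 ∈ Ioo (0 : ℝ) 1) (hy : profile ρ p t y.1 ∈ Ioo (0 : ℝ) 1) :
    ∑ η, p t η * (score (profile ρ p t x.1) (η x) * score (profile ρ p t y.1) (η y)) =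
      corr ρ p t (x.1, y.1) / (profile ρ p t x.1 * (1 - profile ρ p t x.1) *
        (profile ρ p t y.1 * (1 - profile ρ p t y.1))) := by
  set a := profile ρ p t x.1 with ha
  set b := profile ρ p t y.1 with hb
  have h1 : corr ρ p t (x.1, y.1) = ∑ η, p t η * ((occ (η x) - a) * (occ (η y) - b)) := by
    have e : ∀ η, p t η * ((occ (η x) - a) * (occ (η y) - b)) =
        p t η * (occ (η x) * occ (η y)) - p t η * occ (η x) * b - p t η * occ (η y) * a +
          p t η * (a * b) := by
      intro η; ring
    have e1 : ∑ η, p t η * occ (η x) = a := by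
      simp only [ha, profile, extOcc_site]
    have e2 : ∑ η, p t η * occ (η y) = b := by
      simp only [hb, profile, extOcc_site]
    simp only [e, Finset.sum_add_distrib, Finset.sum_sub_distrib, ← Finset.sum_mul, e1, e2,
      hp.sum_eq_one, corr, extOcc_site, ← ha, ← hb]
    ring
  rw [h1, Finset.sum_div]
  refine Finset.sum_congr rfl fun η _ => ?_
  rw [score_eq hx.1 hx.2, score_eq hy.1 hy.2, div_mul_div_comm, mul_div_assoc']

/-- A differential inequality for the entropy. -/
theorem deriv_entropy_le (hp : IsForwardSolution n ρ p) (hn : 3 ≤ n) {ε K t : ℝ} (hε : 0 < ε)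
    (hK : 0 ≤ K) (ht : 0 ≤ t) (hρ : ρ ∈ Icc ε (1 - ε)) (hpos : ∀ η, 0 < p t η)
    (hu : ∀ k, profile ρ p t k ∈ Icc ε (1 - ε))
    (hgrad : ∀ k, k < n → |profile ρ p t (k + 1) - profile ρ p t k| ≤ K / n * Real.exp (-2 * t))
    (hcorr : ∀ z w, 0 < z → z < w → w < n → - corr ρ p t (z, w) ≤ 2 * K ^ 2 / n) :
    deriv (entropy ρ p) t ≤ - (1 / sobolevConst ε K) * entropy ρ p t +
      2 * K ^ 4 / ε ^ 4 * Real.exp (-4 * t) := by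
  have hn0 : (0 : ℝ) < n := by exact_mod_cast (by omega : 0 < n)
  have hw : ∀ (x : Site n) b, 0 < siteWeight (profile ρ p t x.1) b := fun x b =>
    hε.trans_le (siteWeight_mem (hu x.1) b).1
  have h1 := hp.entropy_production_le hn (fun b => hε.le.trans (rate_mem hρ b).1) hpos hw
  set U := profile ρ p t with hU
  set ν := weight (fun x : Site n => U x.1) with hν
  have hν0 : ∀ η, 0 < ν η := fun η => Finset.prod_pos fun x _ => hw x _
  have hνf : ∀ η, ν η * (p t η / ν η) = p t η := fun η => mul_div_cancel₀ _ (hν0 η).ne'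
  have hlsi := entropy_le_dirichlet (n := n) (by omega) hε hK hρ (u := fun x : Site n => U x.1)
    (fun x => hu x.1) (fun x y hxy => by
      have hx := Finset.mem_Ioo.1 x.2
      have := hgrad x.1 hx.2
      simp only [hxy]
      refine this.trans (mul_le_of_le_one_right (by positivity) ?_)
      exact Real.exp_le_one_iff.2 (by linarith))
    (f := fun η => p t η / ν η) (fun η => div_pos (hpos η) (hν0 η)) (by
      rw [← hν]
      simp only [hνf]
      exact hp.sum_eq_one t)
  rw [← hν] at hlsi
  have hent : ∑ η, ν η * (p t η / ν η * Real.log (p t η / ν η)) = entropy ρ p t := by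
    refine Finset.sum_congr rfl fun η _ => ?_
    rw [← mul_assoc, hνf, Real.log_div (hpos η).ne' (hν0 η).ne', hν, log_weight fun x => hw x _]
  rw [hent] at hlsi
  have hC := sobolevConst_pos hε hK
  have h2 : 1 / sobolevConst ε K * entropy ρ p t ≤
      dirichlet n ρ (fun x : Site n => U x.1) (fun η => √(p t η / ν η)) := by
    rw [one_div_mul_eq_div, div_le_iff₀ hC, mul_comm]
    exact hlsi
  have hE : Real.exp (-2 * t) ^ 2 = Real.exp (-4 * t) := by
    rw [← Real.exp_nat_mul]
    congr 1
    push_cast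
    ring
  have h3 : - ∑ η, p t η * ((n : ℝ) ^ 2 * ∑ x : Site n, ∑ y : Site n, if y.1 = x.1 + 1 then
      (U y.1 - U x.1) ^ 2 * (score (U x.1) (η x) * score (U y.1) (η y)) else 0) =
      (n : ℝ) ^ 2 * ∑ x : Site n, ∑ y : Site n, if y.1 = x.1 + 1 then
        (U y.1 - U x.1) ^ 2 * (- corr ρ p t (x.1, y.1) /
          (U x.1 * (1 - U x.1) * (U y.1 * (1 - U y.1)))) else 0 := by
    have hI : ∀ k, U k ∈ Ioo (0 : ℝ) 1 := fun k =>
      ⟨hε.trans_le (hu k).1, by linarith [(hu k).2]⟩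
    have e : ∀ x y : Site n, (if y.1 = x.1 + 1 then
        (U y.1 - U x.1) ^ 2 * (- corr ρ p t (x.1, y.1) /
          (U x.1 * (1 - U x.1) * (U y.1 * (1 - U y.1)))) else 0) =
        ∑ η, - (p t η * if y.1 = x.1 + 1 then
      (U y.1 - U x.1) ^ 2 * (score (U x.1) (η x) * score (U y.1) (η y)) else 0) := by
      intro x y
      split_ifs
      · rw [neg_div, ← hp.sum_score_mul_score (hI _) (hI _), ← Finset.sum_neg_distrib,
          Finset.mul_sum]
        refine Finset.sum_congr rfl fun η _ => ?_
        ring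
      · simp
    simp only [e]
    rw [Finset.sum_congr rfl fun x _ => Finset.sum_comm, Finset.sum_comm, Finset.mul_sum,
      ← Finset.sum_neg_distrib]
    refine Finset.sum_congr rfl fun η _ => ?_
    simp only [Finset.sum_neg_distrib, ← Finset.mul_sum]
    ring
  have h4 : (∑ x : Site n, ∑ y : Site n, if y.1 = x.1 + 1 then
        (U y.1 - U x.1) ^ 2 * (- corr ρ p t (x.1, y.1) /
          (U x.1 * (1 - U x.1) * (U y.1 * (1 - U y.1)))) else 0) ≤
      n * ((K / n * Real.exp (-2 * t)) ^ 2 * ((2 * K ^ 2 / n) / ε ^ 4)) := by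
    rw [sum_bond]
    refine (Finset.sum_le_card_nsmul _ _ _ fun k hk => ?_).trans_eq
      (by rw [Finset.card_range, nsmul_eq_mul])
    split_ifs with h
    · obtain ⟨m1, m2⟩ := h
      rw [Finset.mem_Ioo] at m1 m2
      have g := hgrad k m1.2
      have g2 : (U (k + 1) - U k) ^ 2 ≤ (K / n * Real.exp (-2 * t)) ^ 2 := by
        rw [← sq_abs]
        exact pow_le_pow_left₀ (abs_nonneg _) g 2
      have hc := hcorr k (k + 1) m1.1 (by omega) m2.2
      have hχ : ∀ k, ε ^ 2 ≤ U k * (1 - U k) := by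
        intro k
        have h := hu k
        rw [sq]
        exact mul_le_mul h.1 (by linarith [h.2]) hε.le (hε.le.trans h.1)
      have hχχ : ε ^ 4 ≤ U k * (1 - U k) * (U (k + 1) * (1 - U (k + 1))) := by
        calc ε ^ 4 = ε ^ 2 * ε ^ 2 := by ring
          _ ≤ _ := mul_le_mul (hχ k) (hχ (k + 1)) (by positivity)
            ((by positivity : (0 : ℝ) ≤ ε ^ 2).trans (hχ k))
      refine (mul_le_mul_of_nonneg_left ?_ (sq_nonneg _)).trans
        (mul_le_mul_of_nonneg_right g2 (by positivity))
      exact div_le_div₀ (by positivity) hc (by positivity) hχχ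
    · positivity
  have h5 := mul_le_mul_of_nonneg_left h4 (by positivity : (0 : ℝ) ≤ (n : ℝ) ^ 2)
  -- The powers of `n` cancel: `n²` from the time scale, `n` bonds, `n⁻²` from squared gradients,
  -- `n⁻¹` from correlations.
  have h6 : (n : ℝ) ^ 2 * (n * ((K / n * Real.exp (-2 * t)) ^ 2 * ((2 * K ^ 2 / n) / ε ^ 4))) =
      2 * K ^ 4 / ε ^ 4 * Real.exp (-4 * t) := by
    rw [← hE]
    field_simp
  rw [h6] at h5
  linarith

end IsForwardSolution

/-! ### Exponential decay of the entropy -/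

theorem sum_weight_mul_occ {n : ℕ} (u : Site n → ℝ) (x : Site n) :
    ∑ η, weight u η * occ (η x) = u x := by
  rw [← sum_weight_condAvg u x]
  have : ∀ η, condAvg u x (fun η => occ (η x)) η = u x := by
    intro η
    simp [condAvg, occ, siteWeight]
  simp only [this, ← Finset.sum_mul, sum_weight_eq_one, one_mul]

theorem sum_weight_mul_occ_mul_occ {n : ℕ} (u : Site n → ℝ) {x y : Site n} (hxy : x ≠ y) :
    ∑ η, weight u η * (occ (η x) * occ (η y)) = u x * u y := by
  rw [← sum_weight_condAvg u x]
  have : ∀ η, condAvg u x (fun η => occ (η x) * occ (η y)) η = u x * occ (η y) := by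
    intro η
    simp [condAvg, occ, siteWeight, Function.update_of_ne hxy.symm]
  simp only [this, mul_left_comm, ← Finset.mul_sum, sum_weight_mul_occ]

theorem one_le_sobolevConst {ε K : ℝ} (hε : 0 < ε) (hε1 : ε ≤ 1) (hK : 0 ≤ K) :
    1 ≤ sobolevConst ε K := by
  have hKε : 0 ≤ K / ε ^ 2 := by positivity
  have h1 : 1 ≤ 2 / ε := by rw [le_div_iff₀ hε]; linarith
  have h2 : 1 ≤ Real.exp (K / ε ^ 2) ^ 2 := one_le_pow₀ (Real.one_le_exp hKε)
  have h3 : 1 ≤ ((1 + K / ε ^ 2) / ε + 1) ^ 2 := by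
    refine one_le_pow₀ ?_
    have : 0 ≤ (1 + K / ε ^ 2) / ε := by positivity
    linarith
  have h4 : 1 ≤ 2 * Real.exp (K / ε ^ 2) ^ 2 * ((1 + K / ε ^ 2) / ε + 1) ^ 2 :=
    one_le_mul_of_one_le_of_one_le (by linarith) h3
  have h5 : 1 ≤ 2 * Real.exp (K / ε ^ 2) ^ 2 * ((1 + K / ε ^ 2) / ε + 1) ^ 2 / ε := by
    rw [le_div_iff₀ hε]; linarith
  exact one_le_mul_of_one_le_of_one_le h1 h5

/-- A form of Grönwall's inequality. -/
theorem le_exp_of_deriv_le {H : ℝ → ℝ} {δ M : ℝ} (hδ : δ ≤ 1) (hM : 0 ≤ M)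
    (hd : ∀ t, 0 ≤ t → DifferentiableAt ℝ H t)
    (hH : ∀ t, 0 ≤ t → deriv H t ≤ -δ * H t + M * Real.exp (-4 * t)) (h0 : H 0 = 0) {t : ℝ}
    (ht : 0 ≤ t) : H t ≤ M * Real.exp (-δ * t) := by
  have hE : ∀ c s : ℝ, HasDerivAt (fun s : ℝ => Real.exp (c * s)) (Real.exp (c * s) * c) s := by
    intro c s
    simpa using ((hasDerivAt_id s).const_mul c).exp
  have hder : ∀ s, 0 ≤ s → HasDerivAt (fun s => Real.exp (δ * s) * H s +
      M * Real.exp ((δ - 4) * s)) (Real.exp (δ * s) * δ * H s + Real.exp (δ * s) * deriv H s +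
        M * (Real.exp ((δ - 4) * s) * (δ - 4))) s := fun s hs =>
    ((hE δ s).mul (hd s hs).hasDerivAt).add ((hE (δ - 4) s).const_mul M)
  -- The added term absorbs the forcing: its derivative is `(δ - 4) M e^{(δ - 4) s}`, which
  -- outweighs `M e^{(δ - 4) s}` as `δ ≤ 1`.
  have hanti : AntitoneOn (fun s => Real.exp (δ * s) * H s + M * Real.exp ((δ - 4) * s))
      (Ici 0) := by
    refine antitoneOn_of_deriv_nonpos (convex_Ici 0)
      (fun s hs => (hder s hs).continuousAt.continuousWithinAt)
      (fun s hs => ?_) fun s hs => ?_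
    · rw [interior_Ici] at hs
      exact (hder s (le_of_lt hs)).differentiableAt.differentiableWithinAt
    · rw [interior_Ici] at hs
      rw [(hder s (le_of_lt hs)).deriv]
      have h1 := mul_le_mul_of_nonneg_left (hH s (le_of_lt hs)) (Real.exp_pos (δ * s)).le
      have h2 : Real.exp (δ * s) * Real.exp (-4 * s) = Real.exp ((δ - 4) * s) := by
        rw [← Real.exp_add]
        congr 1
        ring
      have h3 : 0 ≤ M * Real.exp ((δ - 4) * s) := by positivity
      have h4 : Real.exp (δ * s) * (-δ * H s + M * Real.exp (-4 * s)) =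
          - (Real.exp (δ * s) * δ * H s) + M * Real.exp ((δ - 4) * s) := by
        rw [← h2]; ring
      rw [h4] at h1
      nlinarith
  have h := hanti self_mem_Ici ht ht
  simp only [h0, mul_zero, Real.exp_zero, zero_add, mul_one] at h
  have h1 : 0 ≤ M * Real.exp ((δ - 4) * t) := by positivity
  have h2 : Real.exp (δ * t) * H t ≤ M := by linarith
  have h3 : Real.exp (-δ * t) * Real.exp (δ * t) = 1 := by
    rw [← Real.exp_add]
    simp
  calc H t = Real.exp (-δ * t) * (Real.exp (δ * t) * H t) := by rw [← mul_assoc, h3, one_mul]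
    _ ≤ Real.exp (-δ * t) * M := mul_le_mul_of_nonneg_left h2 (Real.exp_pos _).le
    _ = _ := mul_comm _ _

theorem IsProfile.abs_sub_le {ρ ε κ : ℝ} {u₀ : ℝ → ℝ} (h : IsProfile ρ ε κ u₀) {n k : ℕ}
    (hk : k < n) : |u₀ (((k + 1 : ℕ) : ℝ) / n) - u₀ ((k : ℝ) / n)| ≤ κ / n := by
  have hn0 : (0 : ℝ) < n := by exact_mod_cast (by omega : 0 < n)
  have hmem : ∀ j : ℕ, j ≤ n → (j : ℝ) / n ∈ Icc (0 : ℝ) 1 := by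
    intro j hj
    refine ⟨by positivity, ?_⟩
    rw [div_le_one hn0]
    exact_mod_cast hj
  have := (convex_Icc (0 : ℝ) 1).norm_image_sub_le_of_norm_derivWithin_le h.differentiableOn
    (C := κ) (fun x hx => by simpa using h.abs_deriv_le x hx) (hmem k hk.le) (hmem (k + 1) hk)
  rw [Real.norm_eq_abs, Real.norm_eq_abs] at this
  refine this.trans_eq ?_
  have e : ((k + 1 : ℕ) : ℝ) / n - (k : ℝ) / n = 1 / n := by
    push_cast
    ring
  rw [e, abs_of_pos (by positivity)]
  ring

theorem profile_zero {n : ℕ} {ρ : ℝ} {p : ℝ → Config n → ℝ}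
    {u : Site n → ℝ} (h0 : p 0 = weight u) (x : Site n) : profile ρ p 0 x.1 = u x := by
  simp only [profile, extOcc_site, h0, sum_weight_mul_occ]

theorem corr_zero {n : ℕ} {ρ : ℝ} {p : ℝ → Config n → ℝ} {u : Site n → ℝ}
    (h0 : p 0 = weight u) {z w : ℕ} (hz : 0 < z) (hzw : z < w) (hw : w < n) : corr ρ p 0 (z, w) = 0 := by
  have mz : z ∈ Finset.Ioo 0 n := Finset.mem_Ioo.2 ⟨hz, hzw.trans hw⟩
  have mw : w ∈ Finset.Ioo 0 n := Finset.mem_Ioo.2 ⟨hz.trans hzw, hw⟩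
  have hne : (⟨z, mz⟩ : Site n) ≠ ⟨w, mw⟩ := fun h => hzw.ne (congrArg Subtype.val h)
  have h1 := profile_zero (ρ := ρ) h0 ⟨z, mz⟩
  have h2 := profile_zero (ρ := ρ) h0 ⟨w, mw⟩
  have h3 := sum_weight_mul_occ_mul_occ u hne
  simp only [← extOcc_site ρ] at h3
  simp only at h1 h2
  simp only [corr, h1, h2, h0]
  linarith

namespace IsForwardSolution

variable {n : ℕ} {ρ : ℝ} {p : ℝ → Config n → ℝ}

theorem profile_zero_eq (hp : IsForwardSolution n ρ p) {ε κ : ℝ} {u₀ : ℝ → ℝ}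
    (hu₀ : IsProfile ρ ε κ u₀) (h0 : p 0 = weight fun x : Site n => u₀ ((x.1 : ℝ) / n)) {k : ℕ}
    (hn : 0 < n) (hk : k ≤ n) : profile ρ p 0 k = u₀ ((k : ℝ) / n) := by
  by_cases hm : k ∈ Finset.Ioo 0 n
  · exact profile_zero h0 ⟨k, hm⟩
  · rw [hp.profile_of_notMem 0 hm]
    rw [Finset.mem_Ioo] at hm
    rcases Nat.eq_zero_or_pos k with rfl | hk0
    · simp [hu₀.left]
    · have : k = n := by omega
      rw [this, div_self (by exact_mod_cast hn.ne'), hu₀.right]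

/-- The entropy decays exponentially fast, uniformly in `n`. -/
theorem entropy_le (hp : IsForwardSolution n ρ p) (hn : 3 ≤ n) {ε κ : ℝ} (hε : 0 < ε)
    (hκ : 0 ≤ κ) (hρ : ρ ∈ Icc ε (1 - ε)) {u₀ : ℝ → ℝ} (hu₀ : IsProfile ρ ε κ u₀)
    (h0 : p 0 = weight fun x : Site n => u₀ ((x.1 : ℝ) / n)) {t : ℝ} (ht : 0 ≤ t) :
    (∀ η, 0 < p t η) ∧ (∀ k, profile ρ p t k ∈ Icc ε (1 - ε)) ∧
      entropy ρ p t ≤ 2 * (4 * κ) ^ 4 / ε ^ 4 *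
        Real.exp (-(1 / sobolevConst ε (4 * κ)) * t) := by
  have hn0 : (0 : ℝ) < n := by exact_mod_cast (by omega : 0 < n)
  have hε1 : ε ≤ 1 := by linarith [hρ.1, hρ.2]
  have hsite : ∀ x : Site n, u₀ ((x.1 : ℝ) / n) ∈ Icc ε (1 - ε) := by
    intro x
    have hx := Finset.mem_Ioo.1 x.2
    refine hu₀.mem_Icc _ ⟨by positivity, ?_⟩
    rw [div_le_one hn0]
    exact_mod_cast hx.2.le
  have hprof0 : ∀ k, profile ρ p 0 k ∈ Icc ε (1 - ε) := by
    intro k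
    by_cases hm : k ∈ Finset.Ioo 0 n
    · rw [profile_zero h0 ⟨k, hm⟩]
      exact hsite ⟨k, hm⟩
    · rwa [hp.profile_of_notMem 0 hm]
  have hprof : ∀ s, 0 ≤ s → ∀ k, profile ρ p s k ∈ Icc ε (1 - ε) := fun s hs k =>
    hp.profile_mem hn hρ hprof0 hs k
  have hpos : ∀ s, 0 ≤ s → ∀ η, 0 < p s η := fun s hs η =>
    hp.pos ⟨hε.le.trans hρ.1, by linarith [hρ.2]⟩
      (fun η => by rw [h0]; exact weight_pos hε hsite η) hs η
  have hgrad0 : ∀ k, k < n → |profile ρ p 0 (k + 1) - profile ρ p 0 k| ≤ κ / n := by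
    intro k hk
    rw [hp.profile_zero_eq hu₀ h0 (by omega) hk, hp.profile_zero_eq hu₀ h0 (by omega) hk.le]
    exact hu₀.abs_sub_le hk
  -- The factor `4` of the gradient estimate is why the final constants involve `4 * κ`.
  have hgrad : ∀ s, 0 ≤ s → ∀ k, k < n →
      |profile ρ p s (k + 1) - profile ρ p s k| ≤ 4 * κ / n * Real.exp (-2 * s) := by
    intro s hs k hk
    refine (hp.profile_gradient_le hn (by positivity) hgrad0 hs hk).trans_eq ?_
    ring
  have hgrad' : ∀ s, 0 ≤ s → ∀ k, k < n →
      |profile ρ p s (k + 1) - profile ρ p s k| ≤ 4 * κ / n := fun s hs k hk =>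
    (hgrad s hs k hk).trans (mul_le_of_le_one_right (by positivity)
      (Real.exp_le_one_iff.2 (by linarith)))
  have hw : ∀ s, 0 ≤ s → ∀ (x : Site n) b, 0 < siteWeight (profile ρ p s x.1) b :=
    fun s hs x b => hε.trans_le (siteWeight_mem (hprof s hs x.1) b).1
  refine ⟨hpos t ht, hprof t ht, ?_⟩
  refine le_exp_of_deriv_le ?_ (by positivity)
    (fun s hs => (hp.hasDerivAt_entropy hn (hpos s hs) (hw s hs)).differentiableAt)
    (fun s hs => hp.deriv_entropy_le hn hε (by positivity) hs hρ (hpos s hs) (hprof s hs)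
      (hgrad s hs) fun z w hz hzw hw =>
        hp.neg_corr_le hn hgrad' (fun _ _ => corr_zero h0) hs hz hzw hw) ?_ ht
  · have := one_le_sobolevConst hε hε1 (by positivity : 0 ≤ 4 * κ)
    rw [div_le_one (by linarith)]
    exact this
  · refine Finset.sum_eq_zero fun η _ => ?_
    have : p 0 η = weight (fun x : Site n => profile ρ p 0 x.1) η := by
      simp only [profile_zero h0, h0]
    rw [← log_weight fun x => hw 0 le_rfl x _, ← this, sub_self, mul_zero]

end IsForwardSolution

/-! ### The law of the process -/

theorem bernoulliProduct_singleton {n : ℕ} (u : Site n → ℝ) (η : Config n) :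
    bernoulliProduct u {η} = ENNReal.ofReal (weight u η) := by
  simp only [bernoulliProduct, Measure.finsetSum_apply, Measure.smul_apply, smul_eq_mul]
  rw [Finset.sum_eq_single η]
  · simp [weight, siteWeight]
  · intro ξ _ hξ
    simp [hξ]
  · simp

theorem klDiv_bernoulliProduct {n : ℕ} {μ : Measure (Config n)} [IsProbabilityMeasure μ]
    {p : Config n → ℝ} (hμ : ∀ η, μ {η} = ENNReal.ofReal (p η)) (hp : ∀ η, 0 < p η)
    {u : Site n → ℝ} (hw : ∀ η, 0 < weight u η) :
    InformationTheory.klDiv μ (bernoulliProduct u) =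
      ENNReal.ofReal (∑ η, p η * (Real.log (p η) - Real.log (weight u η))) := by
  have hν : IsProbabilityMeasure (bernoulliProduct u) := by
    constructor
    have h := sum_measure_singleton (μ := bernoulliProduct u) (s := Finset.univ)
    simp only [bernoulliProduct_singleton, Finset.coe_univ] at h
    rw [← h, ← ENNReal.ofReal_sum_of_nonneg fun η _ => (hw η).le, sum_weight_eq_one, ENNReal.ofReal_one]
  have hd : μ = (bernoulliProduct u).withDensity
      fun η => ENNReal.ofReal (p η / weight u η) := by
    refine Measure.ext_of_singleton fun η => ?_
    rw [withDensity_apply _ (measurableSet_singleton η), lintegral_singleton,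
      bernoulliProduct_singleton, hμ, ← ENNReal.ofReal_mul (div_pos (hp η) (hw η)).le,
      div_mul_cancel₀ _ (hw η).ne']
  have hac : μ ≪ bernoulliProduct u := by
    rw [hd]
    exact withDensity_absolutelyContinuous _ _
  have hrn : ∀ η, μ.rnDeriv (bernoulliProduct u) η = ENNReal.ofReal (p η / weight u η) := by
    have h := Measure.rnDeriv_withDensity (bernoulliProduct u)
      (f := fun η => ENNReal.ofReal (p η / weight u η)) (measurable_of_finite _)
    rw [← hd] at h
    intro η
    refine (ae_iff_of_countable.1 h) η ?_
    rw [bernoulliProduct_singleton]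
    simpa using hw η
  rw [InformationTheory.klDiv_of_ac_of_integrable hac .of_finite, integral_fintype .of_finite]
  -- `klDiv` includes a difference of total masses, zero for two probability measures.
  simp only [probReal_univ, add_sub_cancel_right, smul_eq_mul]
  congr 1
  refine Finset.sum_congr rfl fun η _ => ?_
  rw [llr, hrn, ENNReal.toReal_ofReal (div_pos (hp η) (hw η)).le,
    Real.log_div (hp η).ne' (hw η).ne', measureReal_def, hμ, ENNReal.toReal_ofReal (hp η).le]

/-- The expectation of `f` at time `t ∈ ℝ`, for the evolution started from the weights `w`. -/
def evolve (n : ℕ) (ρ : ℝ) (w : Config n → ℝ) (t : ℝ) (f : Config n → ℝ) : ℝ :=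
  ∑ ξ, w ξ * NormedSpace.exp (t • LinearMap.toContinuousLinearMap (generator n ρ)) f ξ

theorem hasDerivAt_evolve (n : ℕ) (ρ : ℝ) (w f : Config n → ℝ) (t : ℝ) :
    HasDerivAt (fun s => evolve n ρ w s f) (evolve n ρ w t (generator n ρ f)) t := by
  refine HasDerivAt.fun_sum fun ξ _ => HasDerivAt.const_mul _ ?_
  have h := hasDerivAt_exp_smul_const (𝕂 := ℝ)
    (LinearMap.toContinuousLinearMap (generator n ρ)) t
  have h1 := h.clm_apply (hasDerivAt_const t f)
  have h2 := hasDerivAt_pi.1 h1 ξ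
  simpa using h2

theorem evolve_eq_sum (n : ℕ) (ρ : ℝ) (w : Config n → ℝ) (t : ℝ) (f : Config n → ℝ) :
    ∑ η, evolve n ρ w t (Pi.single η 1) * f η = evolve n ρ w t f := by
  have hf : f = ∑ η, f η • (Pi.single η (1 : ℝ) : Config n → ℝ) := by
    funext ξ
    simp [Finset.sum_apply, Pi.single_apply]
  conv_rhs => rw [hf]
  simp only [evolve, map_sum, map_smul, Finset.sum_apply, Pi.smul_apply, smul_eq_mul,
    Finset.mul_sum, Finset.sum_mul]
  rw [Finset.sum_comm]
  refine Finset.sum_congr rfl fun ξ _ => Finset.sum_congr rfl fun η _ => ?_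
  ring

theorem evolve_zero (n : ℕ) (ρ : ℝ) (w f : Config n → ℝ) :
    evolve n ρ w 0 f = ∑ ξ, w ξ * f ξ := by
  simp [evolve]

/-- The Markov property is applied from time `0` only: the theorem concerns one-time marginals. -/
theorem IsProcess.integral_comp {n : ℕ} {Ω : Type*} [MeasurableSpace Ω] {ρ : ℝ} {u : Site n → ℝ}
    {P : Measure Ω} [IsProbabilityMeasure P] {η : ℝ≥0 → Ω → Config n}
    (h : IsProcess ρ (bernoulliProduct u) P η) (hu : ∀ η, 0 ≤ weight u η) (t : ℝ≥0)
    (f : Config n → ℝ) : ∫ ω, f (η t ω) ∂P = evolve n ρ (weight u) t f := by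
  have hle : past η 0 ≤ ‹MeasurableSpace Ω› :=
    iSup₂_le fun r _ => (h.measurable r).comap_le
  have h1 := h.markov 0 t f
  rw [zero_add] at h1
  rw [← integral_condExp hle, integral_congr_ae h1]
  have h2 : ∫ ω, semigroup n ρ t f (η 0 ω) ∂P = ∫ ξ, semigroup n ρ t f ξ ∂(P.map (η 0)) :=
    (integral_map (h.measurable 0).aemeasurable (measurable_of_finite _).aestronglyMeasurable).symm
  have hfin : IsFiniteMeasure (bernoulliProduct u) := by
    rw [← h.initial]
    infer_instance
  rw [h2, h.initial, integral_fintype .of_finite]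
  refine Finset.sum_congr rfl fun ξ _ => ?_
  rw [measureReal_def, bernoulliProduct_singleton, ENNReal.toReal_ofReal (hu ξ), smul_eq_mul]
  rfl

theorem IsProcess.exists_isForwardSolution {n : ℕ} {Ω : Type*} [MeasurableSpace Ω] {ρ : ℝ}
    {u : Site n → ℝ} {P : Measure Ω} [IsProbabilityMeasure P] {η : ℝ≥0 → Ω → Config n}
    (h : IsProcess ρ (bernoulliProduct u) P η) (hu : ∀ η, 0 ≤ weight u η) :
    ∃ p : ℝ → Config n → ℝ, IsForwardSolution n ρ p ∧ p 0 = weight u ∧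
      (∀ (t : ℝ≥0) ξ, P.map (η t) {ξ} = ENNReal.ofReal (p t ξ)) ∧
      ∀ (t : ℝ≥0) k, density ρ P η t k = profile ρ p t k := by
  have hlaw : ∀ (t : ℝ≥0) ξ, (P.map (η t)).real {ξ} = evolve n ρ (weight u) t (Pi.single ξ 1) := by
    intro t ξ
    rw [← h.integral_comp hu, map_measureReal_apply (h.measurable t) (measurableSet_singleton ξ)]
    have : (fun ω => (Pi.single ξ (1 : ℝ) : Config n → ℝ) (η t ω)) =
        (η t ⁻¹' {ξ}).indicator 1 := by
      funext ω
      by_cases hω : η t ω = ξ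
      · simp [hω]
      · simp [hω]
    rw [this, integral_indicator_one (h.measurable t (measurableSet_singleton ξ))]
  have hsum : ∀ t, ∑ ξ, evolve n ρ (weight u) t (Pi.single ξ 1) = 1 := by
    intro t
    have h1 := evolve_eq_sum n ρ (weight u) t fun _ => 1
    simp only [mul_one] at h1
    have h2 : ∀ s, HasDerivAt (fun s => evolve n ρ (weight u) s fun _ => 1) 0 s := by
      intro s
      have := hasDerivAt_evolve n ρ (weight u) (fun _ => 1) s
      rw [generator_const] at this
      simpa [evolve] using this
    rw [h1, is_const_of_deriv_eq_zero (fun s => (h2 s).differentiableAt)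
      (fun s => (h2 s).deriv) t 0, evolve_zero]
    simp [sum_weight_eq_one]
  have hp : IsForwardSolution n ρ fun t ξ => evolve n ρ (weight u) t (Pi.single ξ 1) := by
    refine ⟨fun f t => ?_, fun t ht ξ => ?_, hsum⟩
    · simp only [evolve_eq_sum]
      exact hasDerivAt_evolve n ρ (weight u) f t
    -- Nonnegativity is read off from the law of the process, so it is available only for `t ≥ 0`,
    -- although the weights are defined for all real times.
    · have := hlaw ⟨t, ht⟩ ξ
      exact this ▸ measureReal_nonneg
  refine ⟨_, hp, ?_, ?_, ?_⟩
  · funext ξ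
    simp [evolve_zero, Pi.single_apply]
  · intro t ξ
    have : IsProbabilityMeasure (P.map (η t)) :=
      Measure.isProbabilityMeasure_map (h.measurable t).aemeasurable
    rw [← hlaw t ξ, ofReal_measureReal]
  · intro t k
    by_cases hk : k ∈ Finset.Ioo 0 n
    · have e : ∀ ξ : Config n, extOcc ρ ξ k = occ (ξ ⟨k, hk⟩) := fun ξ =>
        extOcc_site ρ ξ ⟨k, hk⟩
      simp only [density, hk, dif_pos, profile, e, evolve_eq_sum]
      exact h.integral_comp hu t fun ξ => occ (ξ ⟨k, hk⟩)
    · rw [hp.profile_of_notMem _ hk, density, dif_neg hk]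

/-- With a single site, a law is the Bernoulli measure with the same density. -/
theorem IsForwardSolution.eq_weight_of_two {ρ : ℝ} {p : ℝ → Config 2 → ℝ}
    (hp : IsForwardSolution 2 ρ p) (t : ℝ) (ξ : Config 2) :
    p t ξ = weight (fun x : Site 2 => profile ρ p t x.1) ξ := by
  have m1 : 1 ∈ Finset.Ioo 0 2 := by simp
  have huniq : ∀ x : Site 2, x = ⟨1, m1⟩ := by
    rintro ⟨x, hx⟩
    rw [Finset.mem_Ioo] at hx
    exact Subtype.ext (by simp only; omega)
  have hind : ∀ η : Config 2, siteWeight (occ (η ⟨1, m1⟩)) (ξ ⟨1, m1⟩) = if η = ξ then 1 else 0 := by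
    intro η
    have : η = ξ ↔ η ⟨1, m1⟩ = ξ ⟨1, m1⟩ := by
      refine ⟨fun h => by rw [h], fun h => funext fun x => ?_⟩
      rw [huniq x, h]
    simp only [this]
    cases η ⟨1, m1⟩ <;> cases ξ ⟨1, m1⟩ <;> simp [siteWeight, occ]
  -- `siteWeight` is affine in the density, so its average over deterministic contents is its value
  -- at the mean density.
  have h1 : p t ξ = ∑ η, p t η * siteWeight (occ (η ⟨1, m1⟩)) (ξ ⟨1, m1⟩) := by
    simp [hind]
  have h2 : weight (fun x : Site 2 => profile ρ p t x.1) ξ =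
      siteWeight (profile ρ p t 1) (ξ ⟨1, m1⟩) := by
    rw [weight, Finset.prod_eq_single ⟨1, m1⟩]
    · exact fun x _ hx => absurd (huniq x) hx
    · simp
  have h3 : profile ρ p t 1 = ∑ η, p t η * occ (η ⟨1, m1⟩) :=
    Finset.sum_congr rfl fun η _ => by rw [← extOcc_site ρ η ⟨1, m1⟩]
  rw [h1, h2, h3]
  have h4 : ∀ η, p t η * siteWeight (occ (η ⟨1, m1⟩)) (ξ ⟨1, m1⟩) =
      occ (ξ ⟨1, m1⟩) * (p t η * occ (η ⟨1, m1⟩)) +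
      (1 - occ (ξ ⟨1, m1⟩)) * (p t η - p t η * occ (η ⟨1, m1⟩)) := by
    intro η
    simp only [siteWeight]
    ring
  rw [Finset.sum_congr rfl fun η _ => h4 η, Finset.sum_add_distrib, ← Finset.mul_sum,
    ← Finset.mul_sum, Finset.sum_sub_distrib, hp.sum_eq_one, siteWeight]

end SSEP

end

/-! ### Conclusion -/

theorem theorem2 (ε₀ κ : ℝ) (hε₀ : 0 < ε₀) (hκ : 0 ≤ κ) :
    ∃ C₀ δ₀ : ℝ, 0 < C₀ ∧ 0 < δ₀ ∧
      ∀ (ρ : ℝ), ε₀ ≤ min ρ (1 - ρ) →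
      ∀ (u₀ : ℝ → ℝ), SSEP.IsProfile ρ ε₀ κ u₀ →
      ∀ (n : ℕ), 2 ≤ n →
      ∀ (Ω : Type*) [MeasurableSpace Ω] (P : Measure Ω) [IsProbabilityMeasure P]
        (η : ℝ≥0 → Ω → SSEP.Config n),
        SSEP.IsProcess ρ (SSEP.bernoulliProduct fun x : SSEP.Site n => u₀ ((x.1 : ℝ) / n)) P η →
        (3 ≤ n → SSEP.IsHeatSolution n ρ u₀ (SSEP.density ρ P η)) ∧
        ∀ t : ℝ≥0,
          InformationTheory.klDiv (P.map (η t))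
              (SSEP.bernoulliProduct fun x : SSEP.Site n => SSEP.density ρ P η t x.1)
            ≤ ENNReal.ofReal (C₀ * Real.exp (-δ₀ * t)) := by
  have hC := SSEP.sobolevConst_pos hε₀ (by positivity : 0 ≤ 4 * κ)
  -- The summand `1` keeps `C₀` positive when `κ = 0`.
  refine ⟨2 * (4 * κ) ^ 4 / ε₀ ^ 4 + 1, 1 / SSEP.sobolevConst ε₀ (4 * κ), by positivity,
    by positivity, ?_⟩
  intro ρ hρ u₀ hu₀ n hn Ω _ P _ η hη
  have hρ' : ρ ∈ Icc ε₀ (1 - ε₀) := by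
    rw [le_min_iff] at hρ
    exact ⟨hρ.1, by linarith [hρ.2]⟩
  have hn0 : (0 : ℝ) < n := by exact_mod_cast (by omega : 0 < n)
  have hsite : ∀ x : SSEP.Site n, u₀ ((x.1 : ℝ) / n) ∈ Icc ε₀ (1 - ε₀) := by
    intro x
    have hx := Finset.mem_Ioo.1 x.2
    refine hu₀.mem_Icc _ ⟨by positivity, ?_⟩
    rw [div_le_one hn0]
    exact_mod_cast hx.2.le
  obtain ⟨p, hp, hp0, hlaw, hdens⟩ :=
    hη.exists_isForwardSolution fun η => (SSEP.weight_pos hε₀ hsite η).le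
  refine ⟨fun hn3 => ⟨fun t x hx => ?_, fun t => ?_, fun t => ?_, fun x hx => ?_⟩, fun t => ?_⟩
  · have h1 := (hp.hasDerivAt_profile hn3 t hx).hasDerivWithinAt (s := Ici 0)
    have h2 : SSEP.density ρ P η t = SSEP.profile ρ p t := funext fun k => hdens t k
    rw [h2]
    refine h1.congr (fun s hs => ?_) ?_
    · rw [hdens, Real.coe_toNNReal s hs]
    · rw [hdens, Real.coe_toNNReal t t.2]
  · rw [hdens, hp.profile_of_notMem _ (by simp)]
  · rw [hdens, hp.profile_of_notMem _ (by simp)]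
  · rw [hdens]
    exact SSEP.profile_zero hp0 ⟨x, hx⟩
  · have hprob : IsProbabilityMeasure (P.map (η t)) :=
      Measure.isProbabilityMeasure_map (hη.measurable t).aemeasurable
    simp only [hdens]
    -- For `n = 2` the law equals the reference measure, so the entropy vanishes without any
    -- differential inequality.
    rcases hn.eq_or_lt with rfl | hn3
    · have : P.map (η t) = SSEP.bernoulliProduct fun x : SSEP.Site 2 => SSEP.profile ρ p t x.1 := by
        refine Measure.ext_of_singleton fun ξ => ?_
        rw [hlaw, SSEP.bernoulliProduct_singleton, ← hp.eq_weight_of_two]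
      rw [← this, InformationTheory.klDiv_self]
      exact zero_le
    · obtain ⟨hpos, hprof, hent⟩ := hp.entropy_le hn3 hε₀ hκ hρ' hu₀ hp0 t.2
      have hw : ∀ ξ, 0 < SSEP.weight (fun x : SSEP.Site n => SSEP.profile ρ p t x.1) ξ :=
        SSEP.weight_pos hε₀ fun x => hprof x.1
      rw [SSEP.klDiv_bernoulliProduct (hlaw t) hpos hw]
      refine ENNReal.ofReal_le_ofReal ?_
      have he : ∑ ξ, p t ξ * (Real.log (p t ξ) -
          Real.log (SSEP.weight (fun x : SSEP.Site n => SSEP.profile ρ p t x.1) ξ)) =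
          SSEP.entropy ρ p t := by
        refine Finset.sum_congr rfl fun ξ _ => ?_
        rw [SSEP.log_weight (u := fun x : SSEP.Site n => SSEP.profile ρ p t x.1)
          fun x => hε₀.trans_le (SSEP.siteWeight_mem (hprof x.1) _).1]
      rw [he]
      refine hent.trans (mul_le_mul_of_nonneg_right (by linarith) (Real.exp_pos _).le)
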